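/- Let $m\ge 0$ and $n\ge 1$ be integers and let $\alpha_1,\dots,\alpha_m>0$ with $\sum_i\alpha_i=1$ (so in fact $m\geq 1$). Equip $\mathbb{C}^m$, with minimal projections $p_1,\dots,p_m$, with the state $x\mapsto\sum_i\alpha_i x_i$, and $\mathbb{M}_n$, with matrix units $e_{ij}$, with the normalized trace $tr_n$. Let $$(A,\tau)=\Big(\underset{\alpha_1}{\overset{p_1}{\mathbb{C}}}\oplus\dots\oplus\underset{\alpha_m}{\overset{p_m}{\mathbb{C}}}\Big)*(\mathbb{M}_n,tr_n)$$ be the reduced free product. Here $(D,\varphi)$ is the reduced free product of unital $C^*$-algebras with states $(D_i,\varphi_i)$ (having faithful GNS representations) if $D_i$ embeds unitally in $D$ with $\varphi|_{D_i}=\varphi_i$, the family $(D_i)$ is free in $(D,\varphi)$, $D$ is the $C^*$-algebra generated by $\bigcup_i D_i$, and the GNS representation of $\varphi$ is faithful. Let $u=\sum_{i=1}^{n-1}e_{i,i+1}+e_{n1}\in\mathbb{M}_n\subset A$ be the cyclic permutation unitary, and let $$B=C^*\big(\{u^kp_iu^{-k}: 0\le k\le n-1,\ 1\le i\le m\}\cup\{e_{11},\dots,e_{nn}\}\big)\subset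 A .$$ Then: (1) $(B,\tau|_B)$ is the reduced free product of its $n+1$ subalgebras $\mathbb{C}u^kp_1u^{-k}\oplus\dots\oplus\mathbb{C}u^kp_mu^{-k}$ ($0\le k\le n-1$), each a copy of $\mathbb{C}^m$ with weights $\alpha_1,\dots,\alpha_m$, and $\mathbb{C}e_{11}\oplus\dots\oplus\mathbb{C}e_{nn}$, a copy of $\mathbb{C}^n$ with all weights equal to $\frac1n$. (2) $\mathrm{Ad}(u)\colon b\mapsto ubu^*$ restricts to an automorphism of $B$, and the subgroup $G$ of $\mathrm{Aut}(B)$ that it generates is isomorphic to $\mathbb{Z}_n$. (3) $A\cong B\rtimes G$, the reduced crossed product. Explicitly, for every faithful unital representation $\pi$ of $B$ on a Hilbert space $H$ there is a $*$-isomorphism $\Phi$ from $A$ onto the $C^*$-algebra on $\ell^2(G,H)$ generated by the operators $(\tilde\pi(b)\xi)(g)=\pi(g^{-1}(b))\,\xi(g)$, $b\in B$, and $(\lambda_h\xi)(g)=\xi(h^{-1}g)$, $h\in G$, with $\Phi(b)=\tilde\pi(b)$ for all $b\in B$ and $\Phi(u)=\lambda_{\mathrm{Ad}(u)}$. -/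

import Mathlib

open scoped Matrix.Norms.L2Operator ENNReal

namespace ReducedFree

noncomputable section

/-! ### States and GNS representations -/

section States

open scoped ComplexOrder

/-- A state on a unital C*-algebra: a positive unital linear functional. -/
structure State (A : Type*) [CStarAlgebra A] where
  toLinearMap : A →ₗ[ℂ] ℂ
  map_one' : toLinearMap 1 = 1
  nonneg' : ∀ a : A, 0 ≤ toLinearMap (star a * a)

instance {A : Type*} [CStarAlgebra A] : CoeFun (State A) (fun _ => A → ℂ) :=
  ⟨fun φ => φ.toLinearMap⟩

variable {A : Type*} [CStarAlgebra A]

/-- A state as a positive functional in the sense of Mathlib, for the canonical order of the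
C*-algebra (the one whose positive elements are the `star a * a`). -/
def State.toPositiveLinearMap (φ : State A) :
    letI := CStarAlgebra.spectralOrder A
    A →ₚ[ℂ] ℂ :=
  letI := CStarAlgebra.spectralOrder A
  haveI := CStarAlgebra.spectralOrderedRing A
  PositiveLinearMap.mk₀ φ.toLinearMap (fun x hx => by
    obtain ⟨y, rfl⟩ := CStarAlgebra.nonneg_iff_eq_star_mul_self.mp hx
    exact φ.nonneg' y)

/-- The GNS representation associated to the state is faithful. -/
def State.HasFaithfulGNS (φ : State A) : Prop :=
  letI := CStarAlgebra.spectralOrder A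
  haveI := CStarAlgebra.spectralOrderedRing A
  Function.Injective φ.toPositiveLinearMap.gnsStarAlgHom

/-- The restriction of a state to a unital C*-subalgebra. -/
def State.restrict (φ : State A) (S : StarSubalgebra ℂ A) [IsClosed (S : Set A)] : State S where
  toLinearMap := φ.toLinearMap ∘ₗ S.subtype.toAlgHom.toLinearMap
  map_one' := by simpa using φ.map_one'
  nonneg' a := by simpa using φ.nonneg' (a : A)

/-- The state `x ↦ ∑ i, α i * x i` on `ℂ^m`; the weights are positive and add up to one. -/
def weightedState {m : ℕ} (α : Fin m → ℝ) (hα : ∀ i, 0 < α i) (hsum : ∑ i, α i = 1) :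
    State (Fin m → ℂ) where
  toLinearMap := ∑ i, (α i : ℂ) • LinearMap.proj i
  map_one' := by
    simp only [LinearMap.sum_apply, LinearMap.smul_apply, LinearMap.proj_apply, Pi.one_apply,
      smul_eq_mul, mul_one]
    exact_mod_cast hsum
  nonneg' a := by
    simp only [LinearMap.sum_apply, LinearMap.smul_apply, LinearMap.proj_apply, Pi.mul_apply,
      Pi.star_apply, smul_eq_mul]
    exact Finset.sum_nonneg fun i _ =>
      mul_nonneg (by exact_mod_cast (hα i).le) (star_mul_self_nonneg (a i))

/-- The state of `ℂ^n` with all weights equal to `1 / n`. -/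
def uniformState (n : ℕ) [NeZero n] : State (Fin n → ℂ) :=
  weightedState (fun _ => (1 : ℝ) / n)
    (fun _ => by have := NeZero.pos n; positivity)
    (by simp)

/-- The normalized trace `tr_n` on `M_n`. -/
def normalizedTrace (n : ℕ) [NeZero n] : State (Matrix (Fin n) (Fin n) ℂ) where
  toLinearMap := (1 / n : ℂ) • Matrix.traceLinearMap (Fin n) ℂ ℂ
  map_one' := by simp [Matrix.trace_one]
  nonneg' a := by
    simp only [LinearMap.smul_apply, Matrix.traceLinearMap_apply, smul_eq_mul]
    refine mul_nonneg ?_ ?_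
    · have h : (0 : ℝ) ≤ 1 / n := by positivity
      have h' := Complex.zero_le_real.2 h
      push_cast at h'
      exact h'
    · rw [Matrix.star_eq_conjTranspose]
      exact (Matrix.posSemidef_conjTranspose_mul_self a).trace_nonneg

end States

/-! ### Generated C*-subalgebras, freeness, reduced free products -/

section Free

variable {A : Type*} [CStarAlgebra A]

/-- The unital C*-subalgebra generated by a set. -/
def cstarGenerated (s : Set A) : StarSubalgebra ℂ A :=
  (StarAlgebra.adjoin ℂ s).topologicalClosure

instance (s : Set A) : IsClosed (cstarGenerated s : Set A) :=
  StarSubalgebra.isClosed_topologicalClosure _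

/-- Freeness of a family of unital subalgebras: `φ (a₁ ⋯ a_k) = 0` whenever `k ≥ 1`, the `a_j` are
centered, and neighbouring letters come from members of the family with different indices. -/
def IsFree {ι : Type*} (φ : State A) (S : ι → StarSubalgebra ℂ A) : Prop :=
  ∀ w : List (ι × A), w ≠ [] → w.IsChain (fun x y => x.1 ≠ y.1) →
    (∀ x ∈ w, x.2 ∈ S x.1 ∧ φ x.2 = 0) → φ (w.map Prod.snd).prod = 0

/-- A unital C*-algebra with a state, together with a unital `*`-homomorphism into `A`. -/
structure Factor (A : Type*) [CStarAlgebra A] where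
  source : Type*
  [cstarAlgebra : CStarAlgebra source]
  state : State source
  hom : source →⋆ₐ[ℂ] A

attribute [instance] Factor.cstarAlgebra

/-- `(A, φ)` is the reduced free product of the C*-algebras with states `(F i).source`,
`(F i).state` (whose GNS representations are faithful), with respect to the embeddings
`(F i).hom`. These properties determine `(A, φ)` and the embeddings up to a unique
state-preserving isomorphism. -/
structure IsReducedFreeProduct {ι : Type*} (φ : State A) (F : ι → Factor A) : Prop where
  injective : ∀ i, Function.Injective (F i).hom
  map_state : ∀ i x, φ ((F i).hom x) = (F i).state x
  free : IsFree φ (fun i => (F i).hom.range)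
  generates : cstarGenerated (⋃ i, ((F i).hom.range : Set A)) = ⊤
  faithful : φ.HasFaithfulGNS

end Free

/-! ### The reduced crossed product by a discrete group -/

section CrossedProduct

variable {Γ : Type*} {H : Type*} [NormedAddCommGroup H] [InnerProductSpace ℂ H]

/-- The Hilbert space `ℓ²(Γ, H)`. -/
abbrev L2 (Γ H : Type*) [NormedAddCommGroup H] [InnerProductSpace ℂ H] : Type _ :=
  lp (fun _ : Γ => H) 2

/-- The operator `(ξ_g)_g ↦ (T_g ξ_g)_g` on `ℓ²(Γ, H)`, for a bounded family of operators. -/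
def diagonalOperator (T : Γ → H →L[ℂ] H) (C : ℝ) (hT : ∀ g, ‖T g‖ ≤ C) :
    L2 Γ H →L[ℂ] L2 Γ H :=
  have hT' : ∀ g, ‖T g‖ ≤ |C| := fun g => (hT g).trans (le_abs_self C)
  have key : ∀ (ξ : L2 Γ H) (g : Γ), ‖T g (ξ g)‖ ≤ ‖(((|C| : ℝ) : ℂ) • ξ) g‖ := fun ξ g => by
    rw [lp.coeFn_smul, Pi.smul_apply, norm_smul, Complex.norm_real, Real.norm_eq_abs, abs_abs]
    exact (T g).le_of_opNorm_le (hT' g) _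
  LinearMap.mkContinuous
    { toFun := fun ξ => ⟨fun g => T g (ξ g),
        (lp.memℓp (((|C| : ℝ) : ℂ) • ξ)).mono' (key ξ)⟩
      map_add' := fun ξ η => by ext g; simp; rfl
      map_smul' := fun c ξ => by ext g; simp }
    |C| (fun ξ => by
      refine (lp.norm_mono (by norm_num) (key ξ)).trans ?_
      rw [lp.norm_const_smul (by norm_num), Complex.norm_real, Real.norm_eq_abs, abs_abs])

/-- The translation operator `(λ_h ξ)(g) = ξ(h⁻¹ g)` on `ℓ²(Γ, H)`. -/
def translation [Group Γ] (h : Γ) : L2 Γ H →L[ℂ] L2 Γ H :=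
  LinearMap.mkContinuous
    { toFun := fun ξ => ⟨fun g => ξ (h⁻¹ * g), by
        have hs := (memℓp_gen_iff (p := 2) (by norm_num)).1 (lp.memℓp ξ)
        exact (memℓp_gen_iff (p := 2) (by norm_num)).2
          ((Equiv.mulLeft h⁻¹).summable_iff.2 hs)⟩
      map_add' := fun ξ η => by ext g; simp; rfl
      map_smul' := fun c ξ => by ext g; simp }
    1 (fun ξ => by
      rw [one_mul, lp.norm_eq_tsum_rpow (by norm_num), lp.norm_eq_tsum_rpow (by norm_num)]
      exact le_of_eq (congrArg (· ^ (1 / (2 : ℝ≥0∞).toReal))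
        ((Equiv.mulLeft h⁻¹).tsum_eq (fun g => ‖ξ g‖ ^ (2 : ℝ≥0∞).toReal))))

variable {B : Type*} [CStarAlgebra B] [CompleteSpace H] [Group Γ]

/-- The operator `(π̃(b) ξ)(g) = π(α_{g⁻¹}(b)) ξ(g)` on `ℓ²(Γ, H)`. -/
def inducedRep (π : B →⋆ₐ[ℂ] (H →L[ℂ] H)) (α : Γ →* (B ≃⋆ₐ[ℂ] B)) (b : B) :
    L2 Γ H →L[ℂ] L2 Γ H :=
  diagonalOperator (fun g => π (α g⁻¹ b)) ‖b‖ (fun g =>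
    (NonUnitalStarAlgHom.norm_apply_le π _).trans (NonUnitalStarAlgHom.norm_apply_le (α g⁻¹) b))

/-- The reduced crossed product of `B` by the discrete group `Γ` acting through `α`, realized by
means of a representation `π` of `B` on `H` (which has to be faithful): the C*-algebra on
`ℓ²(Γ, H)` generated by the operators `π̃(b)` and `λ_h`. -/
def reducedCrossedProduct (π : B →⋆ₐ[ℂ] (H →L[ℂ] H)) (α : Γ →* (B ≃⋆ₐ[ℂ] B)) :
    StarSubalgebra ℂ (L2 Γ H →L[ℂ] L2 Γ H) :=
  cstarGenerated (Set.range (inducedRep π α) ∪ Set.range translation)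

end CrossedProduct

/-! ### The algebra in question -/

/-- The cyclic permutation unitary `u` of `M_n`: ones on the superdiagonal and in the lower left
corner. -/
def cyclicPerm (n : ℕ) [NeZero n] : Matrix (Fin n) (Fin n) ℂ :=
  Matrix.of fun i j => if j = i + 1 then 1 else 0

/-- The C*-subalgebra `B` generated by the `u^k p_i u^{-k}` and the diagonal matrix units
`e_{ii}`. Here `p_i` and `e_{ii}` are the images under the embeddings of the minimal projections of
`ℂ^m` and of the matrix units. -/
def rotatedSubalgebra {A : Type*} [CStarAlgebra A] {m n : ℕ} [NeZero n]
    (p : (Fin m → ℂ) →⋆ₐ[ℂ] A) (e : Matrix (Fin n) (Fin n) ℂ →⋆ₐ[ℂ] A) : StarSubalgebra ℂ A :=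
  cstarGenerated
    ({x | ∃ (k : Fin n) (i : Fin m), x =
        e (cyclicPerm n) ^ (k : ℕ) * p (Pi.single i 1) * star (e (cyclicPerm n)) ^ (k : ℕ)} ∪
      {x | ∃ i : Fin n, x = e (Matrix.single i i 1)})

instance {A : Type*} [CStarAlgebra A] {m n : ℕ} [NeZero n]
    (p : (Fin m → ℂ) →⋆ₐ[ℂ] A) (e : Matrix (Fin n) (Fin n) ℂ →⋆ₐ[ℂ] A) :
    IsClosed (rotatedSubalgebra p e : Set A) :=
  StarSubalgebra.isClosed_topologicalClosure _

end

end ReducedFree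

open ReducedFree

/-!
# A free product with `M_n` as a crossed product by `ℤ / n`

Write `u` for the cyclic permutation, `P` for the copy of `ℂ^m`, `D` for the diagonal of `M_n` and
`B` for the algebra generated by `D` and the rotated copies `u ^ k * P * u ^ (-k)`.

The state is a trace, because a free product of traces is a trace (`IsFree.tracial`), and a trace
with faithful GNS representation is faithful (`State.eq_zero_of_tracial`). Hence its restriction to
`B` is faithful as well.

The freeness of the generators of `B` is read off from words. Between two letters from `P`, a
reduced word in the rotated copies and `D` has a factor `u ^ (-k) * u ^ l` with `k ≠ l`, or
`u ^ (-k) * d * u ^ l` with a centered diagonal `d`. These factors have trace zero, so the word is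
also reduced for the free pair `(P, M_n)`, up to a factor from `M_n` at either end
(`Reduced.rotated`). Such an end factor may be multiplied by a power of `u`, so the same computation
gives more: `τ (u ^ j * b) = 0` for all `b ∈ B` when `n` does not divide `j`
(`state_pow_mul_eq_zero`).

This orthogonality determines the crossed product (`exists_starAlgEquiv_reducedCrossedProduct`).
For a finite group the sums `∑ g, π̃(b_g) λ_g` already form a closed algebra, since each coefficient
is bounded by the norm of the sum. The map sending such a sum to `∑ g, b_g U_g` is a
`*`-homomorphism, injective because the faithful trace recovers the coefficients. It is therefore
isometric, with closed range, and onto because the range contains generators. The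
isomorphism is its inverse.
-/

namespace ReducedFree

/-! ### States -/

namespace State

open scoped ComplexOrder

variable {A : Type*} [CStarAlgebra A]

theorem continuous (φ : State A) : Continuous φ := by
  let := CStarAlgebra.spectralOrder A
  have := CStarAlgebra.spectralOrderedRing A
  exact map_continuous φ.toPositiveLinearMap

/-- A tracial state with faithful GNS representation is faithful: its left kernel is then a
two-sided ideal, which the GNS representation annihilates. -/
theorem eq_zero_of_tracial (φ : State A) (hφ : φ.HasFaithfulGNS)
    (htr : ∀ a b : A, φ (a * b) = φ (b * a)) {a : A} (ha : φ (star a * a) = 0) : a = 0 := by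
  let := CStarAlgebra.spectralOrder A
  have := CStarAlgebra.spectralOrderedRing A
  have key : ∀ b : A, φ (star (a * b) * (a * b)) = 0 := by
    intro b
    have h1 : φ (star (a * b) * (a * b)) = φ (star (star a) * (b * star b) * star a) := by
      rw [htr]
      simp [mul_assoc]
    have h2 : star (star a) * (b * star b) * star a ≤
        ‖b * star b‖ • (star (star a) * star a) :=
      CStarAlgebra.star_left_conjugate_le_norm_smul
    have h3 := OrderHomClass.mono φ.toPositiveLinearMap h2
    have h4 : φ.toPositiveLinearMap (‖b * star b‖ • (star (star a) * star a)) = 0 := by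
      have : φ (star (star a) * star a) = 0 := by
        rw [star_star, htr, ha]
      rw [← Complex.coe_smul, map_smul]
      change _ • φ _ = 0
      rw [this, smul_zero]
    rw [h4] at h3
    exact le_antisymm (h1 ▸ h3) (φ.nonneg' _)
  refine hφ ?_
  rw [map_zero]
  ext x
  induction x using UniformSpace.Completion.induction_on with
  | hp => exact isClosed_eq (by fun_prop) (by fun_prop)
  | ih x =>
    have : ‖φ.toPositiveLinearMap.leftMulMapPreGNS a x‖ = 0 := by
      rw [PositiveLinearMap.preGNS_norm_def]
      have := key (φ.toPositiveLinearMap.ofPreGNS x)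
      change √(φ (star (a * φ.toPositiveLinearMap.ofPreGNS x) *
        (a * φ.toPositiveLinearMap.ofPreGNS x))).re = 0
      rw [this]
      simp
    rw [zero_apply, ← norm_eq_zero, ← this]
    exact (congrArg norm (PositiveLinearMap.gnsNonUnitalStarAlgHom_apply_coe _)).trans
      (UniformSpace.Completion.norm_coe _)

/-- A faithful state has a faithful GNS representation. -/
theorem hasFaithfulGNS_of_faithful (φ : State A)
    (h : ∀ a : A, φ (star a * a) = 0 → a = 0) : φ.HasFaithfulGNS := by
  let := CStarAlgebra.spectralOrder A
  have := CStarAlgebra.spectralOrderedRing A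
  refine (injective_iff_map_eq_zero _).2 fun a ha => h a ?_
  have h1 := DFunLike.congr_fun ha (φ.toPositiveLinearMap.toPreGNS 1 : φ.toPositiveLinearMap.GNS)
  have h2 : ‖φ.toPositiveLinearMap.leftMulMapPreGNS a (φ.toPositiveLinearMap.toPreGNS 1)‖ = 0 := by
    rw [zero_apply, ← norm_eq_zero] at h1
    rw [← h1]
    exact ((congrArg norm (PositiveLinearMap.gnsNonUnitalStarAlgHom_apply_coe _)).trans
      (UniformSpace.Completion.norm_coe _)).symm
  have h3 := PositiveLinearMap.preGNS_norm_sq _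
    (φ.toPositiveLinearMap.leftMulMapPreGNS a (φ.toPositiveLinearMap.toPreGNS 1))
  rw [h2] at h3
  have h4 : φ (star (a * 1) * (a * 1)) = 0 := by
    refine Eq.trans h3.symm ?_
    simp
  simpa using h4

end State

/-! ### Reduced words and freeness -/

section Words

variable {A : Type*} [CStarAlgebra A] {ι : Type*}

/-- `Reduced φ S i a`: the element `a` is a product of one or more centered letters from the
subalgebras `S j`, neighbouring letters coming from different indices and the leftmost one from
`S i`. -/
inductive Reduced (φ : State A) (S : ι → StarSubalgebra ℂ A) : ι → A → Prop
  | single {i : ι} {a : A} : a ∈ S i → φ a = 0 → Reduced φ S i a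
  | cons {i j : ι} {a b : A} : a ∈ S i → φ a = 0 → i ≠ j → Reduced φ S j b →
      Reduced φ S i (a * b)

variable {φ : State A} {S : ι → StarSubalgebra ℂ A}

theorem Reduced.exists_list {i : ι} {a : A} (h : Reduced φ S i a) :
    ∃ (x : A) (w : List (ι × A)), ((i, x) :: w).IsChain (fun x y => x.1 ≠ y.1) ∧
      (∀ y ∈ (i, x) :: w, y.2 ∈ S y.1 ∧ φ y.2 = 0) ∧
      (((i, x) :: w).map Prod.snd).prod = a := by
  induction h with
  | @single i a ha h0 => exact ⟨a, [], by simp, by simpa using ⟨ha, h0⟩, by simp⟩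
  | @cons i j a b ha h0 hij _ ih =>
    obtain ⟨x, w, hc, hw, hp⟩ := ih
    refine ⟨a, (j, x) :: w, ?_, ?_, ?_⟩
    · exact List.isChain_cons_cons.2 ⟨hij, hc⟩
    · intro y hy
      rcases List.mem_cons.1 hy with rfl | hy
      · exact ⟨ha, h0⟩
      · exact hw y hy
    · rw [List.map_cons, List.prod_cons, hp]

theorem reduced_of_list (i : ι) (x : A) (w : List (ι × A))
    (hc : ((i, x) :: w).IsChain (fun x y => x.1 ≠ y.1))
    (hw : ∀ y ∈ (i, x) :: w, y.2 ∈ S y.1 ∧ φ y.2 = 0) :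
    Reduced φ S i (((i, x) :: w).map Prod.snd).prod := by
  induction w generalizing i x with
  | nil =>
    have := hw (i, x) (by simp)
    simpa using Reduced.single this.1 this.2
  | cons y w ih =>
    have hx := hw (i, x) (by simp)
    rw [List.map_cons, List.prod_cons]
    rw [List.isChain_cons_cons] at hc
    exact .cons hx.1 hx.2 hc.1 (ih y.1 y.2 hc.2 fun z hz => hw z (List.mem_cons_of_mem _ hz))

/-- Freeness in terms of the inductive predicate instead of lists. -/
theorem isFree_iff_reduced : IsFree φ S ↔ ∀ i a, Reduced φ S i a → φ a = 0 := by
  constructor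
  · intro h i a ha
    obtain ⟨x, w, hc, hw, rfl⟩ := ha.exists_list
    exact h _ (by simp) hc hw
  · intro h w hne hc hw
    obtain ⟨⟨i, x⟩, w, rfl⟩ := List.exists_cons_of_ne_nil hne
    exact h i _ (reduced_of_list i x w hc hw)

variable (φ S) in
/-- The linear span of the reduced words whose leftmost letter comes from `S i`. -/
noncomputable def reducedSpan (i : ι) : Submodule ℂ A := Submodule.span ℂ {a | Reduced φ S i a}

theorem Reduced.mem_reducedSpan {i : ι} {a : A} (h : Reduced φ S i a) : a ∈ reducedSpan φ S i :=
  Submodule.subset_span h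

theorem IsFree.map_reducedSpan (h : IsFree φ S) {i : ι} {a : A} (ha : a ∈ reducedSpan φ S i) :
    φ a = 0 := by
  have : reducedSpan φ S i ≤ LinearMap.ker φ.toLinearMap :=
    Submodule.span_le.2 fun a ha => isFree_iff_reduced.1 h i a ha
  exact this ha

theorem mul_mem_reducedSpan {i j : ι} (hij : i ≠ j) {x b : A} (hx : x ∈ S i) (h0 : φ x = 0)
    (hb : b ∈ reducedSpan φ S j) : x * b ∈ reducedSpan φ S i := by
  have : reducedSpan φ S j ≤ (reducedSpan φ S i).comap (LinearMap.mulLeft ℂ x) :=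
    Submodule.span_le.2 fun b hb => (Reduced.cons hx h0 hij hb).mem_reducedSpan
  exact this hb

theorem map_sub_smul_one (φ : State A) (x : A) : φ (x - φ x • (1 : A)) = 0 := by
  have h := φ.map_one'
  simp [h]

theorem sub_smul_one_mem {i : ι} {x : A} (hx : x ∈ S i) (c : ℂ) : x - c • (1 : A) ∈ S i :=
  sub_mem hx (SMulMemClass.smul_mem c (one_mem _))

/-- Splitting off the scalar part of a letter. -/
theorem mul_eq_centered_add (φ : State A) (x b : A) :
    x * b = (x - φ x • (1 : A)) * b + φ x • b := by
  simp [sub_mul]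

theorem IsFree.map_mul_reducedSpan (h : IsFree φ S) {i j : ι} (hij : i ≠ j) {x b : A}
    (hx : x ∈ S i) (hb : b ∈ reducedSpan φ S j) : φ (x * b) = 0 := by
  rw [mul_eq_centered_add φ, map_add, map_smul, h.map_reducedSpan hb,
    h.map_reducedSpan (mul_mem_reducedSpan hij (sub_smul_one_mem hx _) (map_sub_smul_one φ x) hb),
    smul_zero, add_zero]

variable (φ S) in
/-- The linear span of the unit and of all reduced words. -/
noncomputable def wordSpan : Submodule ℂ A :=
  Submodule.span ℂ ({1} ∪ {a | ∃ i, Reduced φ S i a})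

theorem one_mem_wordSpan : (1 : A) ∈ wordSpan φ S := Submodule.subset_span (Or.inl rfl)

theorem Reduced.mem_wordSpan {i : ι} {a : A} (h : Reduced φ S i a) : a ∈ wordSpan φ S :=
  Submodule.subset_span (Or.inr ⟨i, h⟩)

theorem mem_wordSpan_of_mem {i : ι} {s : A} (hs : s ∈ S i) : s ∈ wordSpan φ S := by
  rw [← mul_one s, mul_eq_centered_add φ, mul_one]
  exact add_mem (Reduced.single (sub_smul_one_mem hs _) (map_sub_smul_one φ s)).mem_wordSpan
    (Submodule.smul_mem _ _ one_mem_wordSpan)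

/-- The word span is stable under left multiplication by letters, so it contains the algebra
generated by them. -/
theorem mul_mem_wordSpan {i : ι} {s a : A} (hs : s ∈ S i) (ha : a ∈ wordSpan φ S) :
    s * a ∈ wordSpan φ S := by
  suffices wordSpan φ S ≤ (wordSpan φ S).comap (LinearMap.mulLeft ℂ s) from this ha
  refine Submodule.span_le.2 ?_
  rintro a (rfl | ⟨j, ha⟩)
  · simpa using mem_wordSpan_of_mem hs
  · change s * a ∈ wordSpan φ S
    by_cases hij : i = j
    · subst hij
      cases ha with
      | single ha _ => exact mem_wordSpan_of_mem (mul_mem hs ha)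
      | cons hx _ hij hb =>
        rw [← mul_assoc, mul_eq_centered_add φ]
        exact add_mem (Reduced.cons (sub_smul_one_mem (mul_mem hs hx) _)
          (map_sub_smul_one φ _) hij hb).mem_wordSpan (Submodule.smul_mem _ _ hb.mem_wordSpan)
    · rw [mul_eq_centered_add φ]
      exact add_mem (Reduced.cons (sub_smul_one_mem hs _) (map_sub_smul_one φ _)
        hij ha).mem_wordSpan (Submodule.smul_mem _ _ ha.mem_wordSpan)

theorem mem_wordSpan_of_mem_adjoin {a : A}
    (ha : a ∈ StarAlgebra.adjoin ℂ (⋃ i, (S i : Set A))) : a ∈ wordSpan φ S := by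
  have hstar : star (⋃ i, (S i : Set A)) = ⋃ i, (S i : Set A) := by
    ext x
    simp [Set.mem_iUnion]
  rw [← StarSubalgebra.mem_toSubalgebra, StarAlgebra.adjoin_toSubalgebra, hstar,
    Set.union_self] at ha
  rw [← mul_one a]
  generalize (1 : A) = b, one_mem_wordSpan (φ := φ) (S := S) = hb
  induction ha using Algebra.adjoin_induction generalizing b with
  | mem s hs =>
    obtain ⟨i, hi⟩ := Set.mem_iUnion.1 hs
    exact mul_mem_wordSpan hi hb
  | algebraMap r =>
    rw [Algebra.algebraMap_eq_smul_one, smul_one_mul]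
    exact Submodule.smul_mem _ _ hb
  | add x y _ _ hx hy => rw [add_mul]; exact add_mem (hx b hb) (hy b hb)
  | mul x y _ _ hx hy => rw [mul_assoc]; exact hx _ (hy b hb)

/-- In an algebra generated by the `S i`, a closed linear subspace which contains the unit and all
reduced words is everything. -/
theorem mem_of_reduced_mem (hgen : cstarGenerated (⋃ i, (S i : Set A)) = ⊤) {V : Submodule ℂ A}
    (hV : IsClosed (V : Set A)) (h1 : (1 : A) ∈ V) (hred : ∀ i a, Reduced φ S i a → a ∈ V)
    (a : A) : a ∈ V := by
  have h2 : wordSpan φ S ≤ V := by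
    refine Submodule.span_le.2 ?_
    rintro x (rfl | ⟨i, hx⟩)
    exacts [h1, hred i x hx]
  have ha : a ∈ (cstarGenerated (⋃ i, (S i : Set A)) : Set A) := by rw [hgen]; trivial
  rw [cstarGenerated, StarSubalgebra.topologicalClosure_coe] at ha
  exact closure_minimal (fun x hx => h2 (mem_wordSpan_of_mem_adjoin hx)) hV ha

/-- Multiplying a reduced word by a letter on the right does not affect the index of its leftmost
letter, except that a scalar may appear. -/
theorem Reduced.mul_letter_mem {j k : ι} {b s : A} (hb : Reduced φ S j b) (hs : s ∈ S k) :
    b * s ∈ Submodule.span ℂ {1} ⊔ reducedSpan φ S j := by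
  have h1 : (1 : A) ∈ Submodule.span ℂ {(1 : A)} := Submodule.mem_span_singleton_self 1
  have hsplit : ∀ x s : A, x * s = x * (s - φ s • (1 : A)) + φ s • x := fun x s => by
    simp [mul_sub]
  induction hb with
  | @single i b hb h0 =>
    by_cases hik : i = k
    · subst hik
      rw [← mul_one (b * s), mul_eq_centered_add φ, mul_one, add_comm]
      exact add_mem (Submodule.mem_sup_left (Submodule.smul_mem _ _ h1))
        (Submodule.mem_sup_right (Reduced.single (sub_smul_one_mem (mul_mem hb hs) _)
          (map_sub_smul_one φ _)).mem_reducedSpan)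
    · rw [hsplit]
      refine Submodule.mem_sup_right (add_mem (Reduced.cons hb h0 hik (.single
        (sub_smul_one_mem hs _) (map_sub_smul_one φ _))).mem_reducedSpan
        (Submodule.smul_mem _ _ (Reduced.single hb h0).mem_reducedSpan))
  | @cons i j x b hx h0 hij hb ih =>
    obtain ⟨c, hc, d, hd, hcd⟩ := Submodule.mem_sup.1 ih
    obtain ⟨r, rfl⟩ := Submodule.mem_span_singleton.1 hc
    rw [mul_assoc, ← hcd, mul_add, mul_smul_comm, mul_one]
    exact Submodule.mem_sup_right (add_mem
      (Submodule.smul_mem _ _ (Reduced.single hx h0).mem_reducedSpan)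
      (mul_mem_reducedSpan hij hx h0 hd))

/-- Reduced words of length at least two still have expectation zero after multiplication by one
letter, on either side. -/
theorem IsFree.map_cons_mul (h : IsFree φ S) {i j k : ι} {x b s : A} (hx : x ∈ S i)
    (h0 : φ x = 0) (hij : i ≠ j) (hb : Reduced φ S j b) (hs : s ∈ S k) :
    φ (s * (x * b)) = 0 ∧ φ (x * b * s) = 0 := by
  constructor
  · by_cases hki : k = i
    · subst hki
      rw [← mul_assoc]
      exact h.map_mul_reducedSpan hij (mul_mem hs hx) hb.mem_reducedSpan
    · exact h.map_mul_reducedSpan hki hs (Reduced.cons hx h0 hij hb).mem_reducedSpan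
  · obtain ⟨c, hc, d, hd, hcd⟩ := Submodule.mem_sup.1 (hb.mul_letter_mem hs)
    obtain ⟨r, rfl⟩ := Submodule.mem_span_singleton.1 hc
    rw [mul_assoc, ← hcd, mul_add, mul_smul_comm, mul_one, map_add, map_smul, h0, smul_zero,
      zero_add]
    exact h.map_reducedSpan (mul_mem_reducedSpan hij hx h0 hd)

/-- A free product of traces is a trace. Only letters `s` have to be compared with reduced words
`w`; both `φ (s * w)` and `φ (w * s)` vanish unless `w` is a single letter from the same algebra. -/
theorem IsFree.tracial (h : IsFree φ S) (hgen : cstarGenerated (⋃ i, (S i : Set A)) = ⊤)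
    (htr : ∀ i, ∀ a ∈ S i, ∀ b ∈ S i, φ (a * b) = φ (b * a)) (a b : A) :
    φ (a * b) = φ (b * a) := by
  have hcont := φ.continuous
  have hletter : ∀ k, ∀ s ∈ S k, ∀ a, φ (s * a) = φ (a * s) := by
    intro k s hs a
    let V : Submodule ℂ A := LinearMap.eqLocus
      (φ.toLinearMap ∘ₗ LinearMap.mulLeft ℂ s) (φ.toLinearMap ∘ₗ LinearMap.mulRight ℂ s)
    refine mem_of_reduced_mem (φ := φ) hgen (V := V) ?_ ?_ ?_ a
    · exact isClosed_eq (hcont.comp (continuous_const_mul s)) (hcont.comp (continuous_mul_const s))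
    · simp [V]
    · intro i a ha
      change φ (s * a) = φ (a * s)
      cases ha with
      | single ha h0 =>
        by_cases hki : k = i
        · subst hki
          exact htr k s hs a ha
        -- For letters from different algebras `φ (s * a)` vanishes directly, and `φ (a * s)` does
        -- because `a * s` differs from `a * (s - φ s)` by a multiple of the centered `a`.
        · rw [h.map_mul_reducedSpan hki hs (Reduced.single ha h0).mem_reducedSpan]
          have := h.map_mul_reducedSpan (Ne.symm hki) ha
            (Reduced.single (sub_smul_one_mem hs (φ s)) (map_sub_smul_one φ s)).mem_reducedSpan
          rw [mul_sub, mul_smul_comm, mul_one, map_sub, map_smul, h0, smul_zero, sub_zero] at this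
          exact this.symm
      | cons hx h0 hij hb =>
        rw [(h.map_cons_mul hx h0 hij hb hs).1, (h.map_cons_mul hx h0 hij hb hs).2]
  let V : Submodule ℂ A := LinearMap.eqLocus
    (φ.toLinearMap ∘ₗ LinearMap.mulRight ℂ b) (φ.toLinearMap ∘ₗ LinearMap.mulLeft ℂ b)
  refine mem_of_reduced_mem (φ := φ) hgen (V := V) ?_ ?_ ?_ a
  · exact isClosed_eq (hcont.comp (continuous_mul_const b)) (hcont.comp (continuous_const_mul b))
  · simp [V]
  · intro i a ha
    change φ (a * b) = φ (b * a)
    induction ha generalizing b with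
    | single ha _ => exact hletter _ _ ha b
    | @cons i j x c hx _ _ _ ih =>
      rw [mul_assoc, hletter _ _ hx, mul_assoc, ih, mul_assoc]

end Words

/-! ### Rotated words in the free product -/

section CyclicPermutation

open Matrix

variable {n : ℕ} [NeZero n]

theorem cyclicPerm_pow (k : ℕ) : cyclicPerm n ^ k =
    Matrix.of fun i j => if j = i + Fin.ofNat n k then 1 else 0 := by
  induction k with
  | zero =>
    ext i j
    simp [Matrix.one_apply, eq_comm]
  | succ k ih =>
    have hk : Fin.ofNat n (k + 1) = Fin.ofNat n k + 1 := by
      ext; simp [Fin.val_add]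
    ext i j
    rw [pow_succ, ih, Matrix.mul_apply]
    rw [hk]
    simp only [Matrix.of_apply, cyclicPerm, mul_ite, mul_one, mul_zero, ← ite_and]
    rw [Finset.sum_eq_single (i + Fin.ofNat n k)]
    · simp [add_assoc, -Fin.ofNat_eq_cast]
    · intro b _ hb
      simp [hb, -Fin.ofNat_eq_cast]
    · simp

theorem cyclicPerm_pow_card : cyclicPerm n ^ n = 1 := by
  ext i j
  simp [cyclicPerm_pow, Matrix.one_apply, eq_comm]

/-- With `d` centered, or with `k` and `l` distinct modulo `n`, the trace vanishes. -/
theorem trace_diagonal_mul_cyclicPerm_pow (d : Fin n → ℂ) (k l : ℕ) :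
    (star (cyclicPerm n ^ k) * diagonal d * cyclicPerm n ^ l).trace =
      if Fin.ofNat n k = Fin.ofNat n l then ∑ i, d i else 0 := by
  rw [mul_assoc, Matrix.trace_mul_comm, mul_assoc, Matrix.trace]
  have h : ∀ i, (cyclicPerm n ^ l * star (cyclicPerm n ^ k)) i i =
      if Fin.ofNat n k = Fin.ofNat n l then 1 else 0 := by
    intro i
    simp [Matrix.mul_apply, Matrix.star_apply, cyclicPerm_pow]
  simp only [Matrix.diag_apply, Matrix.diagonal_mul, h]
  split_ifs <;> simp

theorem star_cyclicPerm_mul_self : star (cyclicPerm n) * cyclicPerm n = 1 := by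
  ext i j
  rw [Matrix.mul_apply]
  simp only [Matrix.star_apply, cyclicPerm, Matrix.of_apply, Matrix.one_apply]
  rw [Finset.sum_eq_single (i - 1)]
  · simp [eq_comm]
  · intro b _ hb
    have : i ≠ b + 1 := fun h => hb (by simp [h])
    simp [this]
  · simp

theorem cyclicPerm_mem_unitary : cyclicPerm n ∈ unitary (Matrix (Fin n) (Fin n) ℂ) :=
  ⟨star_cyclicPerm_mul_self, mul_eq_one_comm.1 star_cyclicPerm_mul_self⟩

theorem normalizedTrace_apply (x : Matrix (Fin n) (Fin n) ℂ) :
    normalizedTrace n x = (1 / n : ℂ) * x.trace := rfl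

theorem single_eq_mul_cyclicPerm_pow (i j : Fin n) :
    Matrix.single i j (1 : ℂ) = Matrix.single i i 1 * cyclicPerm n ^ (j - i : Fin n).val := by
  ext a b
  have hj : b = i + Fin.ofNat n (j - i : Fin n).val ↔ j = b := by
    rw [show Fin.ofNat n (j - i : Fin n).val = j - i by ext; simp, add_sub_cancel, eq_comm]
  by_cases ha : i = a
  · subst ha
    rw [Matrix.single_mul_apply_same, cyclicPerm_pow, Matrix.of_apply]
    simp only [hj]
    simp [Matrix.single_apply]
  · rw [Matrix.single_mul_apply_of_ne _ _ _ _ _ (Ne.symm ha)]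
    simp [ha]

end CyclicPermutation

section RotatedWords

open Matrix

variable {A : Type*} [CStarAlgebra A] {n : ℕ} [NeZero n] {τ : State A}
  {S : Fin 2 → StarSubalgebra ℂ A} {e : Matrix (Fin n) (Fin n) ℂ →⋆ₐ[ℂ] A}

theorem mul_mem_reducedSpan_of_mem {i j : Fin 2} (hij : i ≠ j) {x z : A} (hx : x ∈ S i)
    (h0 : τ x = 0) (hz : z ∈ S j) : x * z ∈ reducedSpan τ S i := by
  have h : x * z = x * (z - τ z • (1 : A)) + τ z • x := by simp [mul_sub]
  rw [h]
  exact add_mem (Reduced.cons hx h0 hij (.single (sub_smul_one_mem hz _)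
    (map_sub_smul_one τ z))).mem_reducedSpan
    (Submodule.smul_mem _ _ (Reduced.single hx h0).mem_reducedSpan)

theorem state_diagonal_mul_cyclicPerm_pow (hτ : ∀ x, τ (e x) = normalizedTrace n x)
    {d : Fin n → ℂ} {k l : ℕ} (h : Fin.ofNat n k ≠ Fin.ofNat n l ∨ τ (e (diagonal d)) = 0) :
    τ (star (e (cyclicPerm n) ^ k) * e (diagonal d) * e (cyclicPerm n) ^ l) = 0 := by
  rw [← map_pow, ← map_pow, ← map_star, ← map_mul, ← map_mul, hτ, normalizedTrace_apply,
    trace_diagonal_mul_cyclicPerm_pow]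
  rw [hτ, normalizedTrace_apply, Matrix.trace_diagonal] at h
  rcases h with h | h
  · simp [h, -Fin.ofNat_eq_cast]
  · split_ifs
    exacts [h, mul_zero _]

variable {C : Type*} [CStarAlgebra C] {ψ : State C} {f : C →⋆ₐ[ℂ] A}
  {T : Option (Fin n) → StarSubalgebra ℂ C}

/-- Let `u` be the cyclic permutation. Sorting a reduced word in the rotated copies
`u ^ k * S 0 * u ^ (-k)` and the diagonal with respect to the two free algebras `S 0` and `M_n`
yields a reduced word starting with a letter from `S 0`, up to a left factor from `M_n`: the letters
from `M_n` which appear in between are `u ^ (-k) * u ^ l` with `k ≠ l`, or `u ^ (-k) * d * u ^ l`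
with a centered diagonal `d`, and both have trace zero. -/
theorem Reduced.rotated (htr : ∀ a b, τ (a * b) = τ (b * a)) (he : ∀ x, e x ∈ S 1)
    (hτ : ∀ x, τ (e x) = normalizedTrace n x) (hψ : ∀ c, ψ c = τ (f c))
    (hT : ∀ k : Fin n, ∀ c ∈ T (some k), ∃ x ∈ S 0,
      f c = e (cyclicPerm n) ^ (k : ℕ) * x * star (e (cyclicPerm n) ^ (k : ℕ)))
    (hD : ∀ c ∈ T none, ∃ d, f c = e (diagonal d)) {o : Option (Fin n)} {c : C}
    (hc : Reduced ψ T o c) :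
    (∀ k, o = some k → ∃ y ∈ reducedSpan τ S 0, f c = e (cyclicPerm n) ^ (k : ℕ) * y) ∧
    (o = none → (∃ d, τ (e (diagonal d)) = 0 ∧ f c = e (diagonal d)) ∨
      ∃ d, ∃ k : Fin n, ∃ y ∈ reducedSpan τ S 0, τ (e (diagonal d)) = 0 ∧
        f c = e (diagonal d) * e (cyclicPerm n) ^ (k : ℕ) * y) := by
  have hu : ∀ k, e (cyclicPerm n) ^ k ∈ S 1 := fun k => by rw [← map_pow]; exact he _
  have huu : ∀ k : ℕ, star (e (cyclicPerm n) ^ k) * e (cyclicPerm n) ^ k = 1 := fun k => by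
    rw [← map_pow, ← map_star, ← map_mul,
      (pow_mem cyclicPerm_mem_unitary k).1, map_one]
  have hx0 : ∀ (k : ℕ) (x : A),
      τ (e (cyclicPerm n) ^ k * x * star (e (cyclicPerm n) ^ k)) = τ x := fun k x => by
    rw [htr, ← mul_assoc, huu, one_mul]
  induction hc with
  | @single i c hc h0 =>
    refine ⟨?_, ?_⟩
    · rintro k rfl
      obtain ⟨x, hx, hcx⟩ := hT k c hc
      rw [hψ, hcx, hx0] at h0
      refine ⟨x * star (e (cyclicPerm n) ^ (k : ℕ)), ?_, by rw [hcx, mul_assoc]⟩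
      exact mul_mem_reducedSpan_of_mem (by decide) hx h0 (star_mem (hu _))
    · rintro rfl
      obtain ⟨d, hd⟩ := hD c hc
      exact Or.inl ⟨d, by rw [← hd, ← hψ, h0], hd⟩
  | @cons i j c b hc h0 hij _ ih =>
    refine ⟨?_, ?_⟩
    · rintro k rfl
      obtain ⟨x, hx, hcx⟩ := hT k c hc
      rw [hψ, hcx, hx0] at h0
      cases j with
      | some l =>
        obtain ⟨y, hy, hby⟩ := ih.1 l rfl
        have hkl : Fin.ofNat n k ≠ Fin.ofNat n l := by simpa using hij
        refine ⟨x * (star (e (cyclicPerm n) ^ (k : ℕ)) * e (cyclicPerm n) ^ (l : ℕ) * y), ?_, ?_⟩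
        · refine mul_mem_reducedSpan (by decide) hx h0
            (mul_mem_reducedSpan (by decide) (mul_mem (star_mem (hu _)) (hu _)) ?_ hy)
          simpa using state_diagonal_mul_cyclicPerm_pow (d := 1) hτ (Or.inl hkl)
        · rw [map_mul, hcx, hby]; noncomm_ring
      | none =>
        rcases ih.2 rfl with ⟨d, hd, hbd⟩ | ⟨d, l, y, hy, hd, hbd⟩
        · refine ⟨x * (star (e (cyclicPerm n) ^ (k : ℕ)) * e (diagonal d)), ?_, ?_⟩
          · exact mul_mem_reducedSpan_of_mem (by decide) hx h0 (mul_mem (star_mem (hu _)) (he _))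
          · rw [map_mul, hcx, hbd]; noncomm_ring
        · refine ⟨x * (star (e (cyclicPerm n) ^ (k : ℕ)) * e (diagonal d) *
            e (cyclicPerm n) ^ (l : ℕ) * y), ?_, ?_⟩
          · exact mul_mem_reducedSpan (by decide) hx h0 (mul_mem_reducedSpan (by decide)
              (mul_mem (mul_mem (star_mem (hu _)) (he _)) (hu _))
              (state_diagonal_mul_cyclicPerm_pow hτ (Or.inr hd)) hy)
          · rw [map_mul, hcx, hbd]; noncomm_ring
    · rintro rfl
      obtain ⟨d, hd⟩ := hD c hc
      cases j with
      | none => exact absurd rfl hij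
      | some l =>
        obtain ⟨y, hy, hby⟩ := ih.1 l rfl
        exact Or.inr ⟨d, l, y, hy, by rw [← hd, ← hψ, h0], by rw [map_mul, hd, hby, mul_assoc]⟩

/-- For `j = 0` this is the freeness of the rotated copies and the diagonal; the other `j` give the
orthogonality which makes the whole algebra a crossed product. -/
theorem Reduced.state_pow_mul (hfree : IsFree τ S) (htr : ∀ a b, τ (a * b) = τ (b * a))
    (he : ∀ x, e x ∈ S 1)
    (hτ : ∀ x, τ (e x) = normalizedTrace n x) (hψ : ∀ c, ψ c = τ (f c))
    (hT : ∀ k : Fin n, ∀ c ∈ T (some k), ∃ x ∈ S 0,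
      f c = e (cyclicPerm n) ^ (k : ℕ) * x * star (e (cyclicPerm n) ^ (k : ℕ)))
    (hD : ∀ c ∈ T none, ∃ d, f c = e (diagonal d)) {o : Option (Fin n)} {c : C}
    (hc : Reduced ψ T o c) (j : ℕ) : τ (e (cyclicPerm n) ^ j * f c) = 0 := by
  have hu : ∀ k, e (cyclicPerm n) ^ k ∈ S 1 := fun k => by rw [← map_pow]; exact he _
  have h := hc.rotated htr he hτ hψ hT hD
  cases o with
  | some k =>
    obtain ⟨y, hy, hcy⟩ := h.1 k rfl
    rw [hcy, ← mul_assoc]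
    exact hfree.map_mul_reducedSpan (by decide) (mul_mem (hu _) (hu _)) hy
  | none =>
    rcases h.2 rfl with ⟨d, hd, hcd⟩ | ⟨d, l, y, hy, hd, hcd⟩
    · rw [hcd, htr]
      simpa using state_diagonal_mul_cyclicPerm_pow (k := 0) (l := j) hτ (Or.inr hd)
    · rw [hcd, ← mul_assoc, ← mul_assoc]
      exact hfree.map_mul_reducedSpan (by decide) (mul_mem (mul_mem (hu _) (he _)) (hu _)) hy

/-- The algebra generated by the rotated copies and the diagonal is orthogonal to its translates by
the nontrivial powers of the cyclic permutation. -/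
theorem state_pow_mul_eq_zero (hfree : IsFree τ S) (htr : ∀ a b, τ (a * b) = τ (b * a))
    (he : ∀ x, e x ∈ S 1)
    (hτ : ∀ x, τ (e x) = normalizedTrace n x) (hψ : ∀ c, ψ c = τ (f c))
    (hT : ∀ k : Fin n, ∀ c ∈ T (some k), ∃ x ∈ S 0,
      f c = e (cyclicPerm n) ^ (k : ℕ) * x * star (e (cyclicPerm n) ^ (k : ℕ)))
    (hD : ∀ c ∈ T none, ∃ d, f c = e (diagonal d))
    (hgen : cstarGenerated (⋃ o, (T o : Set C)) = ⊤) {j : ℕ} (hj : ¬ n ∣ j) (c : C) :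
    τ (e (cyclicPerm n) ^ j * f c) = 0 := by
  have hf : Continuous f := AddMonoidHomClass.continuous_of_bound f 1 fun x => by
    rw [one_mul]; exact NonUnitalStarAlgHom.norm_apply_le f x
  refine mem_of_reduced_mem (φ := ψ) hgen (V := LinearMap.ker (τ.toLinearMap ∘ₗ
    LinearMap.mulLeft ℂ (e (cyclicPerm n) ^ j) ∘ₗ f.toAlgHom.toLinearMap)) ?_ ?_ ?_ c
  · exact isClosed_eq (τ.continuous.comp ((continuous_const_mul _).comp hf)) continuous_const
  · have h0 : Fin.ofNat n 0 ≠ Fin.ofNat n j := by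
      intro h
      have := congrArg Fin.val h
      simp only [Fin.val_ofNat, Nat.zero_mod] at this
      exact hj (Nat.dvd_of_mod_eq_zero this.symm)
    simpa using state_diagonal_mul_cyclicPerm_pow (d := 1) hτ (Or.inl h0)
  · intro o c hc
    exact hc.state_pow_mul hfree htr he hτ hψ hT hD j

end RotatedWords

/-! ### Covariant pairs and the regular representation -/

section CovariantPairs

variable {Γ B X : Type*} [Group Γ] [Fintype Γ] [CStarAlgebra B] [Ring X] [StarRing X]
  [Algebra ℂ X]

/-- The element `∑ g, ρ (b g) * U g` attached to a `B`-valued function on the finite group. The pair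
`(ρ, U)` is meant to be covariant, `U g * ρ b = ρ (α g b) * U g`, but this is not required. -/
noncomputable def covariantSum (ρ : B →⋆ₐ[ℂ] X) (U : Γ →* X) : (Γ → B) →ₗ[ℂ] X :=
  ∑ g, LinearMap.mulRight ℂ (U g) ∘ₗ ρ.toAlgHom.toLinearMap ∘ₗ LinearMap.proj g

/-- The convolution product of the crossed product algebra. -/
noncomputable def twistedMul (α : Γ →* (B ≃⋆ₐ[ℂ] B)) (b c : Γ → B) : Γ → B :=
  fun k => ∑ g, b g * α g (c (g⁻¹ * k))

/-- The involution of the crossed product algebra. -/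
noncomputable def twistedStar (α : Γ →* (B ≃⋆ₐ[ℂ] B)) (b : Γ → B) : Γ → B :=
  fun g => α g (star (b g⁻¹))

variable {α : Γ →* (B ≃⋆ₐ[ℂ] B)} {ρ : B →⋆ₐ[ℂ] X} {U : Γ →* X}

theorem covariantSum_apply (b : Γ → B) : covariantSum ρ U b = ∑ g, ρ (b g) * U g := by
  simp [covariantSum]

theorem covariantSum_single [DecidableEq Γ] (g : Γ) (b : B) :
    covariantSum ρ U (Pi.single g b) = ρ b * U g := by
  rw [covariantSum_apply, Finset.sum_eq_single g]
  · simp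
  · intro h _ hg
    simp [hg]
  · simp

theorem covariantSum_mul (hcov : ∀ g b, U g * ρ b = ρ (α g b) * U g) (b c : Γ → B) :
    covariantSum ρ U (twistedMul α b c) = covariantSum ρ U b * covariantSum ρ U c := by
  simp only [covariantSum_apply, twistedMul, map_sum, Finset.sum_mul]
  rw [Finset.sum_comm]
  refine Finset.sum_congr rfl fun g _ => ?_
  rw [Finset.mul_sum]
  refine (Fintype.sum_equiv (Equiv.mulLeft g) _ _ fun h => ?_).symm
  rw [Equiv.coe_mulLeft, inv_mul_cancel_left, map_mul, map_mul, mul_assoc, ← mul_assoc (U g),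
    hcov, mul_assoc, mul_assoc]

theorem covariantSum_star (hcov : ∀ g b, U g * ρ b = ρ (α g b) * U g)
    (hU : ∀ g, star (U g) = U g⁻¹) (b : Γ → B) :
    covariantSum ρ U (twistedStar α b) = star (covariantSum ρ U b) := by
  simp only [covariantSum_apply, twistedStar, star_sum, star_mul, hU, ← map_star]
  refine Fintype.sum_equiv (Equiv.inv Γ) _ _ fun g => ?_
  rw [Equiv.inv_apply, inv_inv, hcov]

end CovariantPairs

section Translation

variable {Γ H : Type*} [Group Γ] [NormedAddCommGroup H] [InnerProductSpace ℂ H]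

theorem translation_apply (h : Γ) (ξ : L2 Γ H) (g : Γ) :
    translation h ξ g = ξ (h⁻¹ * g) := rfl

variable (Γ H) in
/-- `translation` as a representation of the group. -/
noncomputable def translationHom : Γ →* (L2 Γ H →L[ℂ] L2 Γ H) where
  toFun := translation
  map_one' := by ext ξ g; simp [translation_apply]
  map_mul' h k := by ext ξ g; simp [translation_apply, mul_assoc]

end Translation

section RegularRepresentation

variable {Γ B H : Type*} [Group Γ] [CStarAlgebra B] [NormedAddCommGroup H]
  [InnerProductSpace ℂ H] [CompleteSpace H]

theorem inducedRep_apply (π : B →⋆ₐ[ℂ] (H →L[ℂ] H)) (α : Γ →* (B ≃⋆ₐ[ℂ] B)) (b : B)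
    (ξ : L2 Γ H) (g : Γ) : inducedRep π α b ξ g = π (α g⁻¹ b) (ξ g) := rfl

/-- `inducedRep` as a `*`-homomorphism. -/
noncomputable def inducedHom (π : B →⋆ₐ[ℂ] (H →L[ℂ] H)) (α : Γ →* (B ≃⋆ₐ[ℂ] B)) :
    B →⋆ₐ[ℂ] (L2 Γ H →L[ℂ] L2 Γ H) where
  toFun := inducedRep π α
  map_one' := by ext ξ g; simp [inducedRep_apply]
  map_mul' b c := by ext ξ g; simp [inducedRep_apply]
  map_zero' := by ext ξ g; simp [inducedRep_apply]
  map_add' b c := by ext ξ g; simp [inducedRep_apply]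
  commutes' r := by
    ext ξ g
    simp [inducedRep_apply, Algebra.algebraMap_eq_smul_one]
  map_star' b := by
    rw [ContinuousLinearMap.star_eq_adjoint, ContinuousLinearMap.eq_adjoint_iff]
    intro ξ η
    rw [lp.inner_eq_tsum, lp.inner_eq_tsum]
    refine tsum_congr fun g => ?_
    rw [inducedRep_apply, inducedRep_apply, map_star, map_star,
      ContinuousLinearMap.star_eq_adjoint, ContinuousLinearMap.adjoint_inner_left]

theorem star_translation (h : Γ) :
    star (translation h : L2 Γ H →L[ℂ] L2 Γ H) = translation h⁻¹ := by
  rw [ContinuousLinearMap.star_eq_adjoint, eq_comm, ContinuousLinearMap.eq_adjoint_iff]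
  intro ξ η
  rw [lp.inner_eq_tsum, lp.inner_eq_tsum]
  refine Eq.trans (tsum_congr fun g => ?_)
    ((Equiv.mulLeft h).tsum_eq fun g => inner ℂ (ξ g) (translation h η g))
  rw [translation_apply, translation_apply, Equiv.coe_mulLeft, inv_inv, inv_mul_cancel_left]

theorem translation_mul_inducedRep (π : B →⋆ₐ[ℂ] (H →L[ℂ] H)) (α : Γ →* (B ≃⋆ₐ[ℂ] B)) (h : Γ)
    (b : B) : translation h * inducedRep π α b = inducedRep π α (α h b) * translation h := by
  ext ξ g
  simp only [mul_apply_eq_comp, translation_apply, inducedRep_apply]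
  rw [mul_inv_rev, inv_inv, map_mul, StarAlgEquiv.mul_apply]

variable [Fintype Γ]

/-- The coefficient `b g` is the matrix entry at `(g, 1)`, up to the isometries `π` and `α g⁻¹`. -/
theorem norm_le_norm_covariantSum {π : B →⋆ₐ[ℂ] (H →L[ℂ] H)} (hπ : Function.Injective π)
    (α : Γ →* (B ≃⋆ₐ[ℂ] B)) (b : Γ → B) (g : Γ) :
    ‖b g‖ ≤ ‖covariantSum (inducedHom π α) (translationHom Γ H) b‖ := by
  classical
  rw [← NonUnitalStarAlgHom.norm_map (α g⁻¹) (α g⁻¹).injective,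
    ← NonUnitalStarAlgHom.norm_map π hπ]
  refine ContinuousLinearMap.opNorm_le_bound _ (norm_nonneg _) fun ξ => ?_
  have h : covariantSum (inducedHom π α) (translationHom Γ H) b (lp.single 2 1 ξ : L2 Γ H) g =
      π (α g⁻¹ (b g)) ξ := by
    rw [covariantSum_apply, sum_apply, lp.coeFn_sum, Finset.sum_apply,
      Finset.sum_eq_single g]
    · change π (α g⁻¹ (b g)) ((lp.single 2 1 ξ : L2 Γ H) (g⁻¹ * g) ) = _
      simp
    · intro h _ hg
      change π (α g⁻¹ (b h)) ((lp.single 2 1 ξ : L2 Γ H) (h⁻¹ * g) ) = _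
      have : h⁻¹ * g ≠ 1 := fun h' => hg (inv_mul_eq_one.1 h')
      simp [this]
    · simp
  rw [← h]
  refine (lp.norm_apply_le_norm (by norm_num) _ g).trans ?_
  refine (ContinuousLinearMap.le_opNorm _ _).trans_eq ?_
  rw [lp.norm_single (by norm_num)]

end RegularRepresentation

/-! ### Crossed products by finite groups -/

section CrossedProduct

variable {Γ B H : Type*} [Group Γ] [Fintype Γ] [CStarAlgebra B] [NormedAddCommGroup H]
  [InnerProductSpace ℂ H] [CompleteSpace H] {π : B →⋆ₐ[ℂ] (H →L[ℂ] H)}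
  {α : Γ →* (B ≃⋆ₐ[ℂ] B)}

theorem isClosed_range_covariantSum (hπ : Function.Injective π) :
    IsClosed (Set.range (covariantSum (inducedHom π α) (translationHom Γ H))) := by
  have hcont : Continuous (covariantSum (inducedHom π α) (translationHom Γ H)) := by
    have h : Continuous (inducedHom π α) :=
      AddMonoidHomClass.continuous_of_bound _ 1 fun x => by
        rw [one_mul]; exact NonUnitalStarAlgHom.norm_apply_le _ x
    have := fun b => covariantSum_apply (ρ := inducedHom π α) (U := translationHom Γ H) b
    rw [show ⇑(covariantSum (inducedHom π α) (translationHom Γ H)) = _ from funext this]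
    exact continuous_finsetSum _ fun g _ =>
      (h.comp (continuous_apply g)).mul continuous_const
  let T : (Γ → B) →L[ℂ] (L2 Γ H →L[ℂ] L2 Γ H) :=
    ⟨covariantSum (inducedHom π α) (translationHom Γ H), hcont⟩
  have hT : AntilipschitzWith 1 T := T.antilipschitz_of_bound fun b => by
    rw [NNReal.coe_one, one_mul]
    exact (pi_norm_le_iff_of_nonneg (norm_nonneg _)).2 fun g =>
      norm_le_norm_covariantSum hπ α b g
  exact hT.isClosed_range T.uniformContinuous

/-- For a finite group the sums `∑ g, π̃(b_g) λ_g` already form a closed algebra, because their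
coefficients are bounded by their norm. -/
theorem mem_reducedCrossedProduct_iff (hπ : Function.Injective π) {x : L2 Γ H →L[ℂ] L2 Γ H} :
    x ∈ reducedCrossedProduct π α ↔
      ∃ b, covariantSum (inducedHom π α) (translationHom Γ H) b = x := by
  classical
  have hcov : ∀ g b, translationHom Γ H g * inducedHom π α b =
      inducedHom π α (α g b) * translationHom Γ H g := translation_mul_inducedRep π α
  have hU : ∀ g, star (translationHom Γ H g) = translationHom Γ H g⁻¹ := star_translation
  let R : StarSubalgebra ℂ (L2 Γ H →L[ℂ] L2 Γ H) :=
    { carrier := Set.range (covariantSum (inducedHom π α) (translationHom Γ H))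
      mul_mem' := by
        rintro _ _ ⟨b, rfl⟩ ⟨c, rfl⟩
        exact ⟨_, covariantSum_mul hcov b c⟩
      add_mem' := by
        rintro _ _ ⟨b, rfl⟩ ⟨c, rfl⟩
        exact ⟨b + c, map_add _ _ _⟩
      algebraMap_mem' := fun r => ⟨Pi.single 1 (algebraMap ℂ B r), by
        rw [covariantSum_single, AlgHomClass.commutes, map_one, mul_one]⟩
      star_mem' := by
        rintro _ ⟨b, rfl⟩
        exact ⟨_, covariantSum_star hcov hU b⟩ }
  constructor
  · intro hx
    have hle : reducedCrossedProduct π α ≤ R := by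
      refine StarSubalgebra.topologicalClosure_minimal (StarAlgebra.adjoin_le ?_)
        (isClosed_range_covariantSum hπ)
      rintro _ (⟨b, rfl⟩ | ⟨g, rfl⟩)
      · refine ⟨Pi.single 1 b, ?_⟩
        rw [covariantSum_single, map_one, mul_one]
        rfl
      · refine ⟨Pi.single g 1, ?_⟩
        rw [covariantSum_single, map_one, one_mul]
        rfl
    exact hle hx
  · rintro ⟨b, rfl⟩
    rw [covariantSum_apply]
    have h := (StarAlgebra.subset_adjoin ℂ (Set.range (inducedRep π α) ∪
      Set.range (translation : Γ → L2 Γ H →L[ℂ] L2 Γ H))).trans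
      (StarSubalgebra.le_topologicalClosure _)
    exact sum_mem fun g _ => mul_mem (h (Or.inl ⟨b g, rfl⟩)) (h (Or.inr ⟨g, rfl⟩))

variable {A : Type*} [CStarAlgebra A]

/-- The coefficient `b g` is recovered from `φ (ρ (b g)* * (∑ h, ρ (b h) * U h) * U g⁻¹)`, which
equals `φ (ρ (b g)* * ρ (b g))`. -/
theorem covariantSum_injective {φ : State A} {ρ : B →⋆ₐ[ℂ] A} {U : Γ →* A}
    (hφ : ∀ a : A, φ (star a * a) = 0 → a = 0) (hρ : Function.Injective ρ)
    (hE : ∀ b, ∀ g ≠ 1, φ (ρ b * U g) = 0) : Function.Injective (covariantSum ρ U) := by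
  refine (injective_iff_map_eq_zero _).2 fun b hb => funext fun g => ?_
  have h : φ (star (ρ (b g)) * covariantSum ρ U b * U g⁻¹) =
      φ (star (ρ (b g)) * ρ (b g)) := by
    rw [covariantSum_apply, Finset.mul_sum, Finset.sum_mul, map_sum, Finset.sum_eq_single g]
    · rw [← mul_assoc, mul_assoc _ (U g), ← map_mul, mul_inv_cancel, map_one, mul_one]
    · intro k _ hk
      rw [← mul_assoc, mul_assoc _ (U k), ← map_mul, ← map_star, ← map_mul]
      exact hE _ _ fun h => hk (mul_inv_eq_one.1 h)
    · simp
  rw [hb, mul_zero, zero_mul, map_zero] at h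
  exact hρ ((hφ _ h.symm).trans (map_zero ρ).symm)

/-- A C*-algebra `A` generated by a copy of `B` and a unitary representation `U` of a finite group
implementing the action is the reduced crossed product as soon as a faithful state of `A` vanishes
on `B * U g` for `g ≠ 1`. -/
theorem exists_starAlgEquiv_reducedCrossedProduct {φ : State A} {ρ : B →⋆ₐ[ℂ] A} {U : Γ →* A}
    (hφ : ∀ a : A, φ (star a * a) = 0 → a = 0) (hρ : Function.Injective ρ)
    (hcov : ∀ g b, U g * ρ b = ρ (α g b) * U g) (hU : ∀ g, star (U g) = U g⁻¹)
    (hE : ∀ b, ∀ g ≠ 1, φ (ρ b * U g) = 0)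
    (hgen : cstarGenerated (Set.range ρ ∪ Set.range U) = ⊤) (hπ : Function.Injective π) :
    ∃ Φ : A ≃⋆ₐ[ℂ] reducedCrossedProduct π α,
      (∀ b, (Φ (ρ b) : L2 Γ H →L[ℂ] L2 Γ H) = inducedRep π α b) ∧
      ∀ g, (Φ (U g) : L2 Γ H →L[ℂ] L2 Γ H) = translation g := by
  classical
  have : IsClosed (reducedCrossedProduct π α : Set (L2 Γ H →L[ℂ] L2 Γ H)) :=
    StarSubalgebra.isClosed_topologicalClosure _
  have hcov' : ∀ g b, translationHom Γ H g * inducedHom π α b =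
      inducedHom π α (α g b) * translationHom Γ H g := translation_mul_inducedRep π α
  have hU' : ∀ g, star (translationHom Γ H g) = translationHom Γ H g⁻¹ := star_translation
  let T := covariantSum (inducedHom π α) (translationHom Γ H)
  have hT : Function.Injective T := (injective_iff_map_eq_zero _).2 fun b hb => funext fun g => by
    have := norm_le_norm_covariantSum hπ α b g
    change ‖b g‖ ≤ ‖T b‖ at this
    rwa [hb, norm_zero, norm_le_zero_iff] at this
  choose coef hcoef using fun x : reducedCrossedProduct π α =>
    (mem_reducedCrossedProduct_iff hπ).1 x.2
  change ∀ x, T (coef x) = x at hcoef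
  have hcoef_eq : ∀ (x : reducedCrossedProduct π α) b, T b = x → coef x = b :=
    fun x b h => hT ((hcoef x).trans h.symm)
  -- The inverse of the isomorphism: it carries `∑ g, π̃(b_g) λ_g` to `∑ g, b_g U_g`.
  let Ψ : reducedCrossedProduct π α →⋆ₐ[ℂ] A :=
    { toFun := fun x => covariantSum ρ U (coef x)
      map_one' := by
        rw [hcoef_eq 1 (Pi.single 1 1) (by simp [T, covariantSum_single]), covariantSum_single]
        simp
      map_mul' := fun x y => by
        rw [← covariantSum_mul hcov, hcoef_eq (x * y) (twistedMul α (coef x) (coef y))]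
        exact (covariantSum_mul hcov' _ _).trans (congrArg₂ _ (hcoef x) (hcoef y))
      map_zero' := by rw [hcoef_eq 0 0 (by simp), map_zero]
      map_add' := fun x y => by
        rw [← map_add, hcoef_eq (x + y) (coef x + coef y)]
        rw [map_add, hcoef, hcoef]
        rfl
      commutes' := fun r => by
        rw [hcoef_eq _ (Pi.single 1 (algebraMap ℂ B r)), covariantSum_single,
          AlgHomClass.commutes, map_one, mul_one]
        change covariantSum _ _ _ = _
        rw [covariantSum_single, AlgHomClass.commutes, map_one, mul_one]
        rfl
      map_star' := fun x => by
        rw [← covariantSum_star hcov hU, hcoef_eq (star x) (twistedStar α (coef x))]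
        exact (covariantSum_star hcov' hU' _).trans (congrArg star (hcoef x)) }
  have hΨ : ∀ (x : reducedCrossedProduct π α) b, T b = x → Ψ x = covariantSum ρ U b := fun x b h =>
    congrArg (covariantSum ρ U) (hcoef_eq x b h)
  have hinj : Function.Injective Ψ := fun x y h => Subtype.ext <| by
    rw [← hcoef x, ← hcoef y, covariantSum_injective hφ hρ hE h]
  have hmem : ∀ b, T b ∈ reducedCrossedProduct π α := fun b =>
    (mem_reducedCrossedProduct_iff hπ).2 ⟨b, rfl⟩
  have hΨρ : ∀ b, Ψ ⟨T (Pi.single 1 b), hmem _⟩ = ρ b := fun b => by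
    rw [hΨ _ _ rfl, covariantSum_single, map_one, mul_one]
  have hΨU : ∀ g, Ψ ⟨T (Pi.single g 1), hmem _⟩ = U g := fun g => by
    rw [hΨ _ _ rfl, covariantSum_single, map_one, one_mul]
  have hsurj : Function.Surjective Ψ := by
    have hclosed : IsClosed (Ψ.range : Set A) := by
      exact (NonUnitalStarAlgHom.isometry Ψ hinj).isClosedEmbedding.isClosed_range
    have hle : cstarGenerated (Set.range ρ ∪ Set.range U) ≤ Ψ.range := by
      refine StarSubalgebra.topologicalClosure_minimal (StarAlgebra.adjoin_le ?_) hclosed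
      rintro _ (⟨b, rfl⟩ | ⟨g, rfl⟩)
      exacts [⟨_, hΨρ b⟩, ⟨_, hΨU g⟩]
    intro a
    have ha : a ∈ cstarGenerated (Set.range ρ ∪ Set.range U) := by rw [hgen]; trivial
    exact hle ha
  let E := StarAlgEquiv.ofBijective Ψ ⟨hinj, hsurj⟩
  refine ⟨E.symm, fun b => ?_, fun g => ?_⟩
  · have : E.symm (ρ b) = ⟨T (Pi.single 1 b), hmem _⟩ := E.symm_apply_eq.2 (hΨρ b).symm
    rw [this]
    change covariantSum _ _ _ = _
    rw [covariantSum_single, map_one, mul_one]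
    rfl
  · have : E.symm (U g) = ⟨T (Pi.single g 1), hmem _⟩ := E.symm_apply_eq.2 (hΨU g).symm
    rw [this]
    change covariantSum _ _ _ = _
    rw [covariantSum_single, map_one, one_mul]
    rfl

end CrossedProduct

/-! ### The rotated subalgebra and its automorphism -/

section RotatedSubalgebra

open Matrix

variable {A : Type*} [CStarAlgebra A] {m n : ℕ} [NeZero n]

theorem star_mul_of_cyclicPerm (e : Matrix (Fin n) (Fin n) ℂ →⋆ₐ[ℂ] A) :
    star (e (cyclicPerm n)) * e (cyclicPerm n) = 1 := by
  rw [← map_star, ← map_mul, star_cyclicPerm_mul_self, map_one]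

theorem mul_star_of_cyclicPerm (e : Matrix (Fin n) (Fin n) ℂ →⋆ₐ[ℂ] A) :
    e (cyclicPerm n) * star (e (cyclicPerm n)) = 1 := by
  rw [← map_star, ← map_mul, mul_eq_one_comm.1 star_cyclicPerm_mul_self, map_one]

theorem pow_card_of_cyclicPerm (e : Matrix (Fin n) (Fin n) ℂ →⋆ₐ[ℂ] A) :
    e (cyclicPerm n) ^ n = 1 := by
  rw [← map_pow, cyclicPerm_pow_card, map_one]

/-- The image of the cyclic permutation as an element of the unitary group. -/
noncomputable def cyclicUnitary (e : Matrix (Fin n) (Fin n) ℂ →⋆ₐ[ℂ] A) : unitary A :=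
  ⟨e (cyclicPerm n), star_mul_of_cyclicPerm e, mul_star_of_cyclicPerm e⟩

theorem coe_cyclicUnitary_pow (e : Matrix (Fin n) (Fin n) ℂ →⋆ₐ[ℂ] A) (k : ℕ) :
    ((cyclicUnitary e ^ k : unitary A) : A) = e (cyclicPerm n) ^ k := rfl

theorem cyclicUnitary_pow_card (e : Matrix (Fin n) (Fin n) ℂ →⋆ₐ[ℂ] A) :
    cyclicUnitary e ^ n = 1 := Subtype.ext (pow_card_of_cyclicPerm e)

theorem cyclicPerm_mul_diagonal_mul_star (d : Fin n → ℂ) :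
    cyclicPerm n * diagonal d * star (cyclicPerm n) = diagonal fun i => d (i + 1) := by
  have h : cyclicPerm n * diagonal d = diagonal (fun i => d (i + 1)) * cyclicPerm n := by
    ext i j
    rw [mul_diagonal, diagonal_mul, cyclicPerm, Matrix.of_apply]
    split_ifs with h
    · rw [h, mul_comm]
    · simp
  rw [h, mul_assoc, mul_eq_one_comm.1 star_cyclicPerm_mul_self, mul_one]

variable (p : (Fin m → ℂ) →⋆ₐ[ℂ] A) (e : Matrix (Fin n) (Fin n) ℂ →⋆ₐ[ℂ] A)

theorem map_eq_sum {N : ℕ} {X : Type*} [Ring X] [StarRing X] [Algebra ℂ X]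
    (f : (Fin N → ℂ) →⋆ₐ[ℂ] X) (x : Fin N → ℂ) : f x = ∑ i, x i • f (Pi.single i 1) := by
  conv_lhs => rw [← Finset.univ_sum_single x]
  rw [map_sum]
  refine Finset.sum_congr rfl fun i _ => ?_
  rw [← map_smul, ← Pi.single_smul, smul_eq_mul, mul_one]

/-- The diagonal embedding `ℂ^n → M_n`. -/
noncomputable def diagonalStarAlgHom (n : ℕ) : (Fin n → ℂ) →⋆ₐ[ℂ] Matrix (Fin n) (Fin n) ℂ where
  __ := Matrix.diagonalAlgHom ℂ
  map_star' d := by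
    change diagonal (star d) = star (diagonal d)
    rw [Matrix.star_eq_conjTranspose, Matrix.diagonal_conjTranspose]

theorem subset_rotatedSubalgebra :
    ({x | ∃ (k : Fin n) (i : Fin m), x =
        e (cyclicPerm n) ^ (k : ℕ) * p (Pi.single i 1) * star (e (cyclicPerm n)) ^ (k : ℕ)} ∪
      {x | ∃ i : Fin n, x = e (Matrix.single i i 1)}) ⊆ (rotatedSubalgebra p e : Set A) :=
  (StarAlgebra.subset_adjoin ℂ _).trans (StarSubalgebra.le_topologicalClosure _)

theorem rotated_mem (k : Fin n) (x : Fin m → ℂ) :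
    Unitary.conjStarAlgAut ℂ A (cyclicUnitary e ^ (k : ℕ)) (p x) ∈ rotatedSubalgebra p e := by
  rw [map_eq_sum p x, map_sum]
  refine sum_mem fun i _ => ?_
  rw [map_smul]
  refine SMulMemClass.smul_mem _ (subset_rotatedSubalgebra p e (Or.inl ⟨k, i, ?_⟩))
  rw [Unitary.conjStarAlgAut_apply, coe_cyclicUnitary_pow, ← star_pow]

theorem diagonal_mem (d : Fin n → ℂ) : e (diagonal d) ∈ rotatedSubalgebra p e := by
  have h := map_eq_sum (e.comp (diagonalStarAlgHom n)) d
  change e (diagonal d) = ∑ i, d i • e (diagonal (Pi.single i 1)) at h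
  rw [h]
  refine sum_mem fun i _ => ?_
  rw [Matrix.diagonal_single]
  exact SMulMemClass.smul_mem _ (subset_rotatedSubalgebra p e (Or.inr ⟨i, rfl⟩))

/-- The `k`-th rotated copy of `ℂ^m`. -/
noncomputable def rotatedHom (k : Fin n) : (Fin m → ℂ) →⋆ₐ[ℂ] rotatedSubalgebra p e :=
  StarAlgHom.codRestrict
    (((Unitary.conjStarAlgAut ℂ A (cyclicUnitary e ^ (k : ℕ))) : A →⋆ₐ[ℂ] A).comp p)
    _ (rotated_mem p e k)

/-- The diagonal of `M_n` inside the rotated subalgebra. -/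
noncomputable def diagonalHom : (Fin n → ℂ) →⋆ₐ[ℂ] rotatedSubalgebra p e :=
  StarAlgHom.codRestrict (e.comp (diagonalStarAlgHom n)) _ (diagonal_mem p e)

theorem coe_rotatedHom (k : Fin n) (x : Fin m → ℂ) : (rotatedHom p e k x : A) =
    e (cyclicPerm n) ^ (k : ℕ) * p x * star (e (cyclicPerm n) ^ (k : ℕ)) := rfl

theorem coe_diagonalHom (d : Fin n → ℂ) : (diagonalHom p e d : A) = e (diagonal d) := rfl

theorem cstarGenerated_eq_top_of_rotated {s : Set (rotatedSubalgebra p e)}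
    (hq : ∀ k x, rotatedHom p e k x ∈ s) (hd : ∀ d, diagonalHom p e d ∈ s) :
    cstarGenerated s = ⊤ := by
  have hs : s ⊆ cstarGenerated s :=
    (StarAlgebra.subset_adjoin ℂ _).trans (StarSubalgebra.le_topologicalClosure _)
  have hclosed : IsClosed ((cstarGenerated s).map (rotatedSubalgebra p e).subtype : Set A) := by
    have hB : IsClosed (rotatedSubalgebra p e : Set A) := inferInstance
    exact hB.isClosedEmbedding_subtypeVal.isClosedMap _
      (StarSubalgebra.isClosed_topologicalClosure _)
  have hle : rotatedSubalgebra p e ≤ (cstarGenerated s).map (rotatedSubalgebra p e).subtype := by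
    refine StarSubalgebra.topologicalClosure_minimal (StarAlgebra.adjoin_le ?_) hclosed
    rintro _ (⟨k, i, rfl⟩ | ⟨i, rfl⟩)
    · refine ⟨_, hs (hq k (Pi.single i 1)), ?_⟩
      rw [← star_pow]
      rfl
    · refine ⟨_, hs (hd (Pi.single i 1)), ?_⟩
      rw [← Matrix.diagonal_single]
      rfl
  refine eq_top_iff.2 fun b _ => ?_
  obtain ⟨c, hc, hcb⟩ := hle b.2
  rwa [← Subtype.ext hcb]

theorem conj_mem {b : A} (hb : b ∈ rotatedSubalgebra p e) :
    Unitary.conjStarAlgAut ℂ A (cyclicUnitary e) b ∈ rotatedSubalgebra p e := by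
  let f : A →⋆ₐ[ℂ] A := (Unitary.conjStarAlgAut ℂ A (cyclicUnitary e) : A →⋆ₐ[ℂ] A)
  have hf : Continuous f := AddMonoidHomClass.continuous_of_bound f 1 fun x => by
    rw [one_mul]; exact NonUnitalStarAlgHom.norm_apply_le f x
  have hB : IsClosed (rotatedSubalgebra p e : Set A) := inferInstance
  have hle : rotatedSubalgebra p e ≤ (rotatedSubalgebra p e).comap f := by
    refine StarSubalgebra.topologicalClosure_minimal (StarAlgebra.adjoin_le ?_) (hB.preimage hf)
    rintro _ (⟨k, i, rfl⟩ | ⟨i, rfl⟩)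
    · have h : f (e (cyclicPerm n) ^ (k : ℕ) * p (Pi.single i 1) *
          star (e (cyclicPerm n)) ^ (k : ℕ)) = Unitary.conjStarAlgAut ℂ A
            (cyclicUnitary e ^ ((k : ℕ) + 1)) (p (Pi.single i 1)) := by
        rw [pow_succ', Unitary.conjStarAlgAut_mul_apply, ← star_pow]
        rfl
      change f _ ∈ rotatedSubalgebra p e
      rw [h]
      by_cases hk : (k : ℕ) + 1 < n
      · exact rotated_mem p e ⟨k + 1, hk⟩ _
      · have hk' : (k : ℕ) + 1 = n := by have := k.2; omega
        rw [hk', cyclicUnitary_pow_card, ← pow_zero (cyclicUnitary e)]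
        exact rotated_mem p e ⟨0, NeZero.pos n⟩ _
    · have h : f (e (Matrix.single i i 1)) =
          e (cyclicPerm n * diagonal (Pi.single i 1) * star (cyclicPerm n)) := by
        rw [map_mul, map_mul, map_star, Matrix.diagonal_single]
        rfl
      change f _ ∈ rotatedSubalgebra p e
      rw [h, cyclicPerm_mul_diagonal_mul_star]
      exact diagonal_mem p e _
  exact hle hb

theorem conj_pow_mem {b : A} (hb : b ∈ rotatedSubalgebra p e) (k : ℕ) :
    Unitary.conjStarAlgAut ℂ A (cyclicUnitary e ^ k) b ∈ rotatedSubalgebra p e := by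
  induction k with
  | zero => simpa using hb
  | succ k ih =>
    rw [pow_succ', Unitary.conjStarAlgAut_mul_apply]
    exact conj_mem p e ih

/-- The automorphism `Ad(u)` of the rotated subalgebra. It is onto since `Ad(u) ^ n = 1`. -/
noncomputable def rotation : rotatedSubalgebra p e ≃⋆ₐ[ℂ] rotatedSubalgebra p e :=
  StarAlgEquiv.ofBijective
    (StarAlgHom.codRestrict
      ((Unitary.conjStarAlgAut ℂ A (cyclicUnitary e) : A →⋆ₐ[ℂ] A).comp
        (rotatedSubalgebra p e).subtype) (rotatedSubalgebra p e) fun b => conj_mem p e b.2)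
    ⟨fun b c h => Subtype.ext
        ((Unitary.conjStarAlgAut ℂ A (cyclicUnitary e)).injective (congrArg Subtype.val h)),
      fun b => ⟨⟨_, conj_pow_mem p e b.2 (n - 1)⟩, Subtype.ext <| by
        change Unitary.conjStarAlgAut ℂ A (cyclicUnitary e)
          (Unitary.conjStarAlgAut ℂ A (cyclicUnitary e ^ (n - 1)) b) = (b : A)
        rw [← Unitary.conjStarAlgAut_mul_apply, ← pow_succ',
          Nat.sub_add_cancel (NeZero.one_le (n := n)), cyclicUnitary_pow_card, map_one]
        rfl⟩⟩

theorem coe_rotation (b : rotatedSubalgebra p e) : (rotation p e b : A) =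
    e (cyclicPerm n) * (b : A) * star (e (cyclicPerm n)) := rfl

theorem coe_rotation_pow (k : ℕ) (b : rotatedSubalgebra p e) : ((rotation p e ^ k) b : A) =
    e (cyclicPerm n) ^ k * (b : A) * star (e (cyclicPerm n) ^ k) := by
  induction k with
  | zero => simp
  | succ k ih =>
    rw [pow_succ', StarAlgEquiv.mul_apply, coe_rotation, ih, pow_succ', star_mul]
    noncomm_ring

variable {p e}

theorem orderOf_rotation (he : Function.Injective e) : orderOf (rotation p e) = n := by
  refine Nat.dvd_antisymm (orderOf_dvd_of_pow_eq_one ?_) ?_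
  · ext b
    rw [coe_rotation_pow, pow_card_of_cyclicPerm]
    simp
  · have h := congrArg Subtype.val (DFunLike.congr_fun (pow_orderOf_eq_one (rotation p e))
      (diagonalHom p e (Pi.single 0 1)))
    generalize orderOf (rotation p e) = k at h
    rw [coe_rotation_pow, StarAlgEquiv.one_apply, coe_diagonalHom, ← map_pow, ← map_star,
      ← map_mul, ← map_mul] at h
    have h' := congrArg (· * cyclicPerm n ^ k) (he h)
    simp only [mul_assoc, (pow_mem cyclicPerm_mem_unitary k).1, mul_one] at h'
    -- Compare the entries at `(0, k)`: on the left the only nonzero column is the zeroth one.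
    have h'' := congrFun (congrFun h' 0) (Fin.ofNat n k)
    rw [diagonal_mul, mul_diagonal, cyclicPerm_pow, Matrix.of_apply, zero_add] at h''
    have h0 : Fin.ofNat n k = 0 := by
      by_contra hne
      simp [hne, -Fin.ofNat_eq_cast] at h''
    exact Nat.dvd_of_mod_eq_zero (congrArg Fin.val h0)

end RotatedSubalgebra

/-! ### The free product as a crossed product -/

section Assembly

open Matrix

variable {A : Type*} [CStarAlgebra A] {m n : ℕ} [NeZero n] {α : Fin m → ℝ} {hα : ∀ i, 0 < α i}
  {hsum : ∑ i, α i = 1} {τ : State A} {p : (Fin m → ℂ) →⋆ₐ[ℂ] A}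
  {e : Matrix (Fin n) (Fin n) ℂ →⋆ₐ[ℂ] A}

/-- The factors `ℂ^m` and `M_n` carry traces, hence so does their free product. -/
theorem tracial_of_isReducedFreeProduct (hA : IsReducedFreeProduct τ
    ![⟨Fin m → ℂ, weightedState α hα hsum, p⟩,
      ⟨Matrix (Fin n) (Fin n) ℂ, normalizedTrace n, e⟩]) (a b : A) :
    τ (a * b) = τ (b * a) := by
  refine hA.free.tracial hA.generates ?_ a b
  intro i
  fin_cases i
  · have h : ∀ x y, τ (p x * p y) = τ (p y * p x) := fun x y => by
      rw [← map_mul, ← map_mul, mul_comm]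
    rintro _ ⟨x, rfl⟩ _ ⟨y, rfl⟩
    exact h x y
  · have he : ∀ x, τ (e x) = normalizedTrace n x := hA.map_state 1
    have h : ∀ x y, τ (e x * e y) = τ (e y * e x) := fun x y => by
      rw [← map_mul, ← map_mul, he, he, normalizedTrace_apply, normalizedTrace_apply,
        Matrix.trace_mul_comm]
    rintro _ ⟨x, rfl⟩ _ ⟨y, rfl⟩
    exact h x y

variable (α hα hsum p e) in
/-- The rotated copies of `ℂ^m` and the diagonal, as embeddings into the rotated subalgebra. -/
noncomputable def rotatedFactor (o : Option (Fin n)) : Factor (rotatedSubalgebra p e) :=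
  o.elim ⟨Fin n → ℂ, uniformState n, diagonalHom p e⟩
    (fun k => ⟨Fin m → ℂ, weightedState α hα hsum, rotatedHom p e k⟩)

theorem exists_of_mem_range_rotatedFactor_some (k : Fin n) {c : rotatedSubalgebra p e}
    (hc : c ∈ (rotatedFactor α hα hsum p e (some k)).hom.range) : ∃ x ∈ p.range,
      (rotatedSubalgebra p e).subtype c =
        e (cyclicPerm n) ^ (k : ℕ) * x * star (e (cyclicPerm n) ^ (k : ℕ)) := by
  obtain ⟨x, rfl⟩ := hc
  exact ⟨p x, ⟨x, rfl⟩, rfl⟩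

theorem exists_of_mem_range_rotatedFactor_none {c : rotatedSubalgebra p e}
    (hc : c ∈ (rotatedFactor α hα hsum p e none).hom.range) : ∃ d,
      (rotatedSubalgebra p e).subtype c = e (diagonal d) := by
  obtain ⟨d, rfl⟩ := hc
  exact ⟨d, rfl⟩

theorem cstarGenerated_rotatedFactor :
    cstarGenerated (⋃ o, ((rotatedFactor α hα hsum p e o).hom.range :
      Set (rotatedSubalgebra p e))) = ⊤ :=
  cstarGenerated_eq_top_of_rotated p e (fun k x => Set.mem_iUnion.2 ⟨some k, ⟨x, rfl⟩⟩)
    (fun d => Set.mem_iUnion.2 ⟨none, ⟨d, rfl⟩⟩)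

theorem isReducedFreeProduct_rotatedFactor (hA : IsReducedFreeProduct τ
    ![⟨Fin m → ℂ, weightedState α hα hsum, p⟩,
      ⟨Matrix (Fin n) (Fin n) ℂ, normalizedTrace n, e⟩]) :
    IsReducedFreeProduct (τ.restrict (rotatedSubalgebra p e))
      (rotatedFactor α hα hsum p e) := by
  have htr := tracial_of_isReducedFreeProduct hA
  have hτp : ∀ x, τ (p x) = weightedState α hα hsum x := hA.map_state 0
  have hτe : ∀ x, τ (e x) = normalizedTrace n x := hA.map_state 1
  have hp : Function.Injective p := hA.injective 0
  have he : Function.Injective e := hA.injective 1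
  refine ⟨?_, ?_, ?_, cstarGenerated_rotatedFactor, ?_⟩
  · rintro (_ | k)
    · intro x y h
      exact diagonal_injective (he (congrArg Subtype.val h))
    · intro x y h
      exact hp ((Unitary.conjStarAlgAut ℂ A (cyclicUnitary e ^ (k : ℕ))).injective
        (congrArg Subtype.val h))
  · have hd : ∀ x, τ (e (diagonal x)) = uniformState n x := fun x => by
      rw [hτe, normalizedTrace_apply, trace_diagonal, Finset.mul_sum]
      simp [uniformState, weightedState]
    have hq : ∀ (k : ℕ) x, τ (e (cyclicPerm n) ^ k * p x * star (e (cyclicPerm n) ^ k)) =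
        weightedState α hα hsum x := fun k x => by
      rw [htr, ← mul_assoc, ← map_pow, ← map_star, ← map_mul,
        (pow_mem cyclicPerm_mem_unitary k).1, map_one, one_mul, hτp]
    rintro (_ | k) x
    exacts [hd x, hq k x]
  · refine isFree_iff_reduced.2 fun o c hc => ?_
    have := hc.state_pow_mul (f := (rotatedSubalgebra p e).subtype) hA.free htr
      (fun x => ⟨x, rfl⟩) hτe (fun _ => rfl)
      (fun k c hc => exists_of_mem_range_rotatedFactor_some k hc)
      (fun c hc => exists_of_mem_range_rotatedFactor_none hc) 0
    rw [pow_zero, one_mul] at this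
    exact this
  · refine State.hasFaithfulGNS_of_faithful _ fun b hb => Subtype.ext ?_
    exact τ.eq_zero_of_tracial hA.faithful htr hb

/-- The hypothesis which identifies the crossed product: the powers of `u` are orthogonal over the
rotated subalgebra. -/
theorem state_mul_pow_eq_zero (hA : IsReducedFreeProduct τ
    ![⟨Fin m → ℂ, weightedState α hα hsum, p⟩,
      ⟨Matrix (Fin n) (Fin n) ℂ, normalizedTrace n, e⟩]) (b : rotatedSubalgebra p e) {k : ℕ}
    (hk : ¬ n ∣ k) : τ (b * e (cyclicPerm n) ^ k) = 0 := by
  have htr := tracial_of_isReducedFreeProduct hA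
  rw [htr]
  exact state_pow_mul_eq_zero (f := (rotatedSubalgebra p e).subtype)
    (ψ := τ.restrict (rotatedSubalgebra p e)) hA.free htr (fun x => ⟨x, rfl⟩) (hA.map_state 1)
    (fun _ => rfl) (fun k c hc => exists_of_mem_range_rotatedFactor_some k hc)
    (fun c hc => exists_of_mem_range_rotatedFactor_none hc)
    (cstarGenerated_rotatedFactor (α := α) (hα := hα) (hsum := hsum)) hk b

theorem nonempty_zpowers_rotation_mulEquiv (he : Function.Injective e) :
    Nonempty (Subgroup.zpowers (rotation p e) ≃* Multiplicative (ZMod n)) := by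
  refine ⟨mulEquivOfCyclicCardEq ?_⟩
  rw [Nat.card_zpowers, orderOf_rotation he]
  simp

/-- The unitary representation `Ad(u) ^ k ↦ u ^ k` of the group generated by `Ad(u)`. It is well
defined because `u ^ n = 1` and `Ad(u)` has order exactly `n`. -/
theorem exists_unitary_representation (he : Function.Injective e) :
    ∃ U : Subgroup.zpowers (rotation p e) →* unitary A,
      ∀ k : ℕ, U (⟨rotation p e, Subgroup.mem_zpowers _⟩ ^ k) = cyclicUnitary e ^ k := by
  let g : Subgroup.zpowers (rotation p e) := ⟨rotation p e, Subgroup.mem_zpowers _⟩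
  have hg : ∀ x, x ∈ Subgroup.zpowers g := by
    rintro ⟨x, k, rfl⟩
    exact ⟨k, Subtype.ext (by simp [g])⟩
  have hord : orderOf (cyclicUnitary e) ∣ orderOf g := by
    rw [Subgroup.orderOf_mk, orderOf_rotation he]
    exact orderOf_dvd_of_pow_eq_one (cyclicUnitary_pow_card e)
  refine ⟨monoidHomOfForallMemZpowers hg hord, fun k => ?_⟩
  rw [map_pow]
  exact congrArg (· ^ k) (monoidHomOfForallMemZpowers_apply_gen hg hord)

theorem exists_pow_eq_of_isOfFinOrder {G : Type*} [Group G] {g : G} (hg : IsOfFinOrder g)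
    (x : Subgroup.zpowers g) :
    ∃ k : ℕ, (⟨g, Subgroup.mem_zpowers g⟩ : Subgroup.zpowers g) ^ k = x := by
  obtain ⟨k, hk⟩ := hg.mem_powers_iff_mem_zpowers.2 x.2
  exact ⟨k, Subtype.ext hk⟩

/-- The rotated subalgebra and `u` generate everything, as `e_ij = e_ii * u ^ (j - i)`. -/
theorem eq_top_of_rotatedSubalgebra_le (hA : IsReducedFreeProduct τ
    ![⟨Fin m → ℂ, weightedState α hα hsum, p⟩,
      ⟨Matrix (Fin n) (Fin n) ℂ, normalizedTrace n, e⟩]) {R : StarSubalgebra ℂ A}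
    (hR : IsClosed (R : Set A)) (hB : rotatedSubalgebra p e ≤ R) (hu : e (cyclicPerm n) ∈ R) :
    R = ⊤ := by
  have hp : ∀ x, p x ∈ R := fun x => hB (by simpa using rotated_mem p e 0 x)
  have he : ∀ x, e x ∈ R := fun x => by
    rw [Matrix.matrix_eq_sum_single x, map_sum]
    refine sum_mem fun i _ => ?_
    rw [map_sum]
    refine sum_mem fun j _ => ?_
    rw [← mul_one (x i j), ← smul_eq_mul, ← Matrix.smul_single, map_smul,
      single_eq_mul_cyclicPerm_pow, map_mul, map_pow]
    refine SMulMemClass.smul_mem _ (mul_mem (hB ?_) (pow_mem hu _))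
    rw [← Matrix.diagonal_single]
    exact diagonal_mem p e _
  rw [eq_top_iff, ← hA.generates]
  refine StarSubalgebra.topologicalClosure_minimal (StarAlgebra.adjoin_le ?_) hR
  refine Set.iUnion_subset fun i => ?_
  fin_cases i
  · rintro _ ⟨x, rfl⟩
    exact hp x
  · rintro _ ⟨x, rfl⟩
    exact he x

/-- The isomorphism with the crossed product, for the representation `U : Ad(u) ^ k ↦ u ^ k`. -/
theorem exists_starAlgEquiv_of_representation (hA : IsReducedFreeProduct τ
    ![⟨Fin m → ℂ, weightedState α hα hsum, p⟩,
      ⟨Matrix (Fin n) (Fin n) ℂ, normalizedTrace n, e⟩])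
    {H : Type*} [NormedAddCommGroup H] [InnerProductSpace ℂ H] [CompleteSpace H]
    (π : rotatedSubalgebra p e →⋆ₐ[ℂ] (H →L[ℂ] H)) (hπ : Function.Injective π)
    (U : Subgroup.zpowers (rotation p e) →* unitary A)
    (hU : ∀ k : ℕ, U (⟨rotation p e, Subgroup.mem_zpowers _⟩ ^ k) = cyclicUnitary e ^ k) :
    ∃ Φ : A ≃⋆ₐ[ℂ] reducedCrossedProduct π (Subgroup.zpowers (rotation p e)).subtype,
      (∀ b : rotatedSubalgebra p e,
        (Φ (b : A) : L2 (Subgroup.zpowers (rotation p e)) H →L[ℂ]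
          L2 (Subgroup.zpowers (rotation p e)) H) =
          inducedRep π (Subgroup.zpowers (rotation p e)).subtype b) ∧
      (Φ (e (cyclicPerm n)) : L2 (Subgroup.zpowers (rotation p e)) H →L[ℂ]
          L2 (Subgroup.zpowers (rotation p e)) H) =
        translation ⟨rotation p e, Subgroup.mem_zpowers _⟩ := by
  have he : Function.Injective e := hA.injective 1
  have hfin : Finite (Subgroup.zpowers (rotation p e)) := by
    refine Nat.finite_of_card_ne_zero ?_
    rw [Nat.card_zpowers, orderOf_rotation he]
    exact NeZero.ne n
  let _ : Fintype (Subgroup.zpowers (rotation p e)) := Fintype.ofFinite _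
  have hpow := exists_pow_eq_of_isOfFinOrder
    (orderOf_pos_iff.1 ((orderOf_rotation (p := p) he).symm ▸ NeZero.pos n))
  let g₀ : Subgroup.zpowers (rotation p e) := ⟨rotation p e, Subgroup.mem_zpowers _⟩
  let V : Subgroup.zpowers (rotation p e) →* A := (unitary A).subtype.comp U
  have hV : ∀ k : ℕ, V (g₀ ^ k) = e (cyclicPerm n) ^ k :=
    fun k => congrArg Subtype.val (hU k)
  have hcov : ∀ g b, V g * (rotatedSubalgebra p e).subtype b =
      (rotatedSubalgebra p e).subtype ((Subgroup.zpowers (rotation p e)).subtype g b) * V g := by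
    intro g b
    obtain ⟨k, rfl⟩ := hpow g
    rw [hV]
    change _ = ((rotation p e ^ k) b : A) * _
    rw [coe_rotation_pow, mul_assoc, ← map_pow, ← map_star, ← map_mul,
      (pow_mem cyclicPerm_mem_unitary k).1, map_one, mul_one]
    rfl
  have hstar : ∀ g, star (V g) = V g⁻¹ := fun g => by
    change star (U g : A) = (U g⁻¹ : A)
    rw [map_inv]
    rfl
  have hE : ∀ b, ∀ g ≠ 1, τ ((rotatedSubalgebra p e).subtype b * V g) = 0 := by
    intro b g hg
    obtain ⟨k, rfl⟩ := hpow g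
    rw [hV]
    refine state_mul_pow_eq_zero hA b fun hk => hg (Subtype.ext ?_)
    rw [← orderOf_rotation (p := p) he] at hk
    exact orderOf_dvd_iff_pow_eq_one.1 hk
  have hgen : cstarGenerated (Set.range (rotatedSubalgebra p e).subtype ∪ Set.range V) = ⊤ := by
    have hs := (StarAlgebra.subset_adjoin ℂ
      (Set.range (rotatedSubalgebra p e).subtype ∪ Set.range V)).trans
      (StarSubalgebra.le_topologicalClosure _)
    have hB : ∀ b ∈ rotatedSubalgebra p e,
        b ∈ cstarGenerated (Set.range (rotatedSubalgebra p e).subtype ∪ Set.range V) :=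
      fun b hb => hs (Or.inl ⟨⟨b, hb⟩, rfl⟩)
    refine eq_top_of_rotatedSubalgebra_le hA (StarSubalgebra.isClosed_topologicalClosure _) hB ?_
    rw [← pow_one (e (cyclicPerm n)), ← hV]
    exact hs (Or.inr ⟨_, rfl⟩)
  have hV1 : V g₀ = e (cyclicPerm n) := (congrArg V (pow_one g₀).symm).trans
    ((hV 1).trans (pow_one _))
  have h := exists_starAlgEquiv_reducedCrossedProduct
    (fun a => τ.eq_zero_of_tracial hA.faithful (tracial_of_isReducedFreeProduct hA))
    Subtype.val_injective hcov hstar hE hgen hπ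
  exact h.imp fun Φ hΦ => ⟨hΦ.1, (congrArg (fun x => (Φ x).1) hV1.symm).trans (hΦ.2 g₀)⟩

end Assembly

end ReducedFree

open ReducedFree
theorem lemma3p4 {m n : ℕ} [NeZero n] (α : Fin m → ℝ) (hα : ∀ i, 0 < α i)
    (hsum : ∑ i, α i = 1) {A : Type*} [CStarAlgebra A] (τ : State A)
    (p : (Fin m → ℂ) →⋆ₐ[ℂ] A) (e : Matrix (Fin n) (Fin n) ℂ →⋆ₐ[ℂ] A)
    (hA : IsReducedFreeProduct τ
      ![⟨Fin m → ℂ, weightedState α hα hsum, p⟩,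
        ⟨Matrix (Fin n) (Fin n) ℂ, normalizedTrace n, e⟩]) :
    -- `B` is the reduced free product of the `n` rotated copies of `ℂ^m` and the diagonal
    (∃ (q : Fin n → ((Fin m → ℂ) →⋆ₐ[ℂ] rotatedSubalgebra p e))
        (d : (Fin n → ℂ) →⋆ₐ[ℂ] rotatedSubalgebra p e),
      (∀ k i, (q k (Pi.single i 1) : A) =
        e (cyclicPerm n) ^ (k : ℕ) * p (Pi.single i 1) * star (e (cyclicPerm n)) ^ (k : ℕ)) ∧
      (∀ i, (d (Pi.single i 1) : A) = e (Matrix.single i i 1)) ∧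
      IsReducedFreeProduct (τ.restrict (rotatedSubalgebra p e))
        (fun o : Option (Fin n) => o.elim
          ⟨Fin n → ℂ, uniformState n, d⟩
          (fun k => ⟨Fin m → ℂ, weightedState α hα hsum, q k⟩))) ∧
    -- `Ad(u)` is an automorphism `θ` of `B`, it generates a group isomorphic to `ℤ / n`, and `A`
    -- is the reduced crossed product of `B` by this group
    ∃ θ : rotatedSubalgebra p e ≃⋆ₐ[ℂ] rotatedSubalgebra p e,
      (∀ b, (θ b : A) = e (cyclicPerm n) * (b : A) * star (e (cyclicPerm n))) ∧
      Nonempty (Subgroup.zpowers θ ≃* Multiplicative (ZMod n)) ∧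
      ∀ {H : Type*} [NormedAddCommGroup H] [InnerProductSpace ℂ H] [CompleteSpace H]
        (π : rotatedSubalgebra p e →⋆ₐ[ℂ] (H →L[ℂ] H)), Function.Injective π →
        ∃ Φ : A ≃⋆ₐ[ℂ] reducedCrossedProduct π (Subgroup.zpowers θ).subtype,
          (∀ b : rotatedSubalgebra p e,
            (Φ (b : A) : L2 (Subgroup.zpowers θ) H →L[ℂ] L2 (Subgroup.zpowers θ) H) =
              inducedRep π (Subgroup.zpowers θ).subtype b) ∧
          (Φ (e (cyclicPerm n)) :
              L2 (Subgroup.zpowers θ) H →L[ℂ] L2 (Subgroup.zpowers θ) H) =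
            translation ⟨θ, Subgroup.mem_zpowers θ⟩ := by
  refine ⟨⟨rotatedHom p e, diagonalHom p e, fun k i => ?_, fun i => ?_,
    isReducedFreeProduct_rotatedFactor hA⟩, rotation p e, coe_rotation p e,
    nonempty_zpowers_rotation_mulEquiv (hA.injective 1), fun π hπ =>
    (exists_unitary_representation (p := p) (hA.injective 1)).elim fun U hU =>
      exists_starAlgEquiv_of_representation hA π hπ U hU⟩
  · rw [coe_rotatedHom, star_pow]
  · rw [coe_diagonalHom, Matrix.diagonal_single]
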